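/- **Conventions.** For $y\in\mathbb F_2^n$ let $|y|$ be the Hamming weight, and for a linear code $C\subseteq\mathbb F_2^n$ let $|y|_C=\min_{y'\in C}|y+y'|$ and $C^\perp=\{x: x\cdot y=0\ \forall y\in C\}$. A binary CSS code $\mathcal C$ of block length $n$ is given by parity-check matrices $H_X\in\mathbb F_2^{m_X\times n}$, $H_Z\in\mathbb F_2^{m_Z\times n}$ with $C_X=\ker H_X$, $C_Z=\ker H_Z$ and $C_X^\perp\subseteq C_Z$. Its dimension is $k=\dim C_Z-\dim C_X^\perp$ and its distance is $d=\min\{|y|: y\in(C_Z\setminus C_X^\perp)\cup(C_X\setminus C_Z^\perp)\}$; it has locality $\le\ell$ if every row and column of $H_X,H_Z$ has weight $\le\ell$. Its code Hamiltonian is $$\mathbf H=\tfrac12(\mathbf H_X+\mathbf H_Z),\quad \mathbf H_X=\frac1{m_X}\sum_{y\in\mathrm{rows}(H_X)}\frac{I-X^y}{2},\quad \mathbf H_Z=\frac1{m_Z}\sum_{y\in\mathrm{rows}(H_Z)}\frac{I-Z^y}{2}$$ (rows counted with multiplicity, an empty average being $0$), where $X^a|y\rangle=|y+a\rangle$ and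 $Z^a|y\rangle=(-1)^{a\cdot y}|y\rangle$. A (possibly mixed) state $\rho$ is an $\epsilon$-approximate ground state of $\mathbf H$ if $\mathrm{Tr}(\rho\mathbf H)\le\epsilon$. A depth-$t$ quantum circuit consists of $t$ layers, each a product of arbitrary unitary gates acting on pairwise disjoint sets of at most two qubits; it constructs an $n$-qubit state $\rho$ if, run on $|0\rangle^{\otimes(n+a)}$ for some $a\ge0$, it yields $\rho$ after tracing out $a$ qubits. For $c_1,c_2,\epsilon_0>0$, the code $\mathcal C$ exhibits $(c_1,c_2,\epsilon_0)$-clustering if for all $0<\epsilon<\epsilon_0$: every $y$ with $|H_Xy|\le\epsilon m_X$ satisfies $|y|_{C_Z^\perp}\le c_1\epsilon n$ or $|y|_{C_Z^\perp}\ge c_2n$, and every $y$ with $|H_Zy|\le\epsilon m_Z$ satisfies $|y|_{C_X^\perp}\le c_1\epsilon n$ or $|y|_{C_X^\perp}\ge c_2n$. For $c_1,c_2>0$, it has $(c_1,c_2)$-small-set boundary expansion if $|H_Zy|/m_Z\ge c_2|y|_{C_X^\perp}/n$ for all $y$ with $|y|\le c_1n$, and $(c_1,c_2)$-small-set coboundary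 expansion if $|H_Xy|/m_X\ge c_2|y|_{C_Z^\perp}/n$ for all such $y$ (with $0/0=0$). **Statement.** 1. Let $\mathcal C$ be a binary CSS code of block length $n$, dimension $k>0$ and distance $d$ that exhibits $(c_1,c_2,\epsilon_0)$-clustering with $c_1,c_2,\epsilon_0>0$, let $\mathbf H$ be its code Hamiltonian, and let $$\epsilon<\frac1{1000}\min\Big\{\frac{\epsilon_0}{2},\ \frac{c_2}{4c_1},\ \frac{d}{2c_1n}\Big\},\qquad \mu=0.02,\qquad \delta=c_2 .$$ Then no $\epsilon$-approximate ground state of $\mathbf H$ can be constructed by a quantum circuit of depth less than $$\frac13\log_2\Big(\frac{\delta^2n}{400\log_2(1/\mu)}\Big)+1 .$$ 2. Let $(\mathcal C_j)_{j\in\mathbb N}$ be a family of binary CSS codes of block lengths $n_j\to\infty$, of locality at most a constant $\ell$, and of positive dimensions, that all have $(c_1,c_2)$-small-set boundary and coboundary expansion for some constants $c_1,c_2>0$. Then the family of their code Hamiltonians $(\mathbf H_j)$ is NLTS: for some constant $\ell'$ every $\mathbf H_j$ is a sum of Hamiltonians each acting nontrivially on at most $\ell'$ qubits, $0\preceq\mathbf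 H_j\preceq I$, and there is $\epsilon>0$ such that the minimum depth of a quantum circuit constructing an $\epsilon$-approximate ground state of $\mathbf H_j$ tends to infinity as $j\to\infty$. -/

import Mathlib

open Filter Topology
open scoped ComplexOrder

noncomputable section

namespace NLTS

/-! ## Binary CSS codes -/

/-- The dual code `C^⊥ = {x : x · y = 0 for all y ∈ C}`. -/
def dualCode {n : ℕ} (C : Submodule (ZMod 2) (Fin n → ZMod 2)) :
    Submodule (ZMod 2) (Fin n → ZMod 2) where
  carrier := {x | ∀ y ∈ C, x ⬝ᵥ y = 0}
  add_mem' := by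
    intro a b ha hb y hy
    rw [add_dotProduct, ha y hy, hb y hy, add_zero]
  zero_mem' := by
    intro y _
    exact zero_dotProduct y
  smul_mem' := by
    intro c x hx y hy
    rw [smul_dotProduct, hx y hy, smul_zero]

/-- `|y|_C = min_{y' ∈ C} |y + y'|`, where `|·|` is the Hamming weight. -/
def cosetWeight {n : ℕ} (C : Submodule (ZMod 2) (Fin n → ZMod 2)) (y : Fin n → ZMod 2) : ℕ :=
  ⨅ y' : C, hammingNorm (y + (y' : Fin n → ZMod 2))

/-- A binary CSS code of block length `n`, given by parity-check matrices `H_X`, `H_Z` with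
`C_X = ker H_X`, `C_Z = ker H_Z` and `C_X^⊥ ⊆ C_Z`. -/
structure CSSCode (n mX mZ : ℕ) where
  HX : Matrix (Fin mX) (Fin n) (ZMod 2)
  HZ : Matrix (Fin mZ) (Fin n) (ZMod 2)
  dual_le : dualCode (LinearMap.ker HX.mulVecLin) ≤ LinearMap.ker HZ.mulVecLin

namespace CSSCode

variable {n mX mZ : ℕ}

/-- `C_X = ker H_X`. -/
def CX (Q : CSSCode n mX mZ) : Submodule (ZMod 2) (Fin n → ZMod 2) :=
  LinearMap.ker Q.HX.mulVecLin

/-- `C_Z = ker H_Z`. -/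
def CZ (Q : CSSCode n mX mZ) : Submodule (ZMod 2) (Fin n → ZMod 2) :=
  LinearMap.ker Q.HZ.mulVecLin

/-- The dimension `k = dim C_Z - dim C_X^⊥`. -/
def dim (Q : CSSCode n mX mZ) : ℕ :=
  Module.finrank (ZMod 2) Q.CZ - Module.finrank (ZMod 2) (dualCode Q.CX)

/-- The distance `d`: the least Hamming weight of an element of
`(C_Z \ C_X^⊥) ∪ (C_X \ C_Z^⊥)`. -/
def dist (Q : CSSCode n mX mZ) : ℕ :=
  sInf {w | ∃ y : Fin n → ZMod 2,
    ((y ∈ Q.CZ ∧ y ∉ dualCode Q.CX) ∨ (y ∈ Q.CX ∧ y ∉ dualCode Q.CZ)) ∧ hammingNorm y = w}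

/-- Locality at most `ℓ`: all rows and all columns of `H_X`, `H_Z` have Hamming weight `≤ ℓ`. -/
def HasLocality (Q : CSSCode n mX mZ) (ℓ : ℕ) : Prop :=
  (∀ i, hammingNorm (Q.HX i) ≤ ℓ) ∧ (∀ j, hammingNorm (fun i => Q.HX i j) ≤ ℓ) ∧
  (∀ i, hammingNorm (Q.HZ i) ≤ ℓ) ∧ (∀ j, hammingNorm (fun i => Q.HZ i j) ≤ ℓ)

/-- `G_X^ε = {y : |H_X y| ≤ ε m_X}`. -/
def GX (Q : CSSCode n mX mZ) (ε : ℝ) : Set (Fin n → ZMod 2) :=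
  {y | (hammingNorm (Q.HX.mulVec y) : ℝ) ≤ ε * mX}

/-- `G_Z^ε = {y : |H_Z y| ≤ ε m_Z}`. -/
def GZ (Q : CSSCode n mX mZ) (ε : ℝ) : Set (Fin n → ZMod 2) :=
  {y | (hammingNorm (Q.HZ.mulVec y) : ℝ) ≤ ε * mZ}

/-- The `(c₁, c₂, ε₀)`-clustering property. -/
def Clustering (Q : CSSCode n mX mZ) (c₁ c₂ ε₀ : ℝ) : Prop :=
  ∀ ε : ℝ, 0 < ε → ε < ε₀ →
    (∀ y ∈ Q.GX ε, (cosetWeight (dualCode Q.CZ) y : ℝ) ≤ c₁ * ε * n ∨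
      c₂ * n ≤ (cosetWeight (dualCode Q.CZ) y : ℝ)) ∧
    (∀ y ∈ Q.GZ ε, (cosetWeight (dualCode Q.CX) y : ℝ) ≤ c₁ * ε * n ∨
      c₂ * n ≤ (cosetWeight (dualCode Q.CX) y : ℝ))

/-- `(c₁, c₂)`-small-set boundary expansion. -/
def SmallSetBoundaryExpansion (Q : CSSCode n mX mZ) (c₁ c₂ : ℝ) : Prop :=
  ∀ y : Fin n → ZMod 2, (hammingNorm y : ℝ) ≤ c₁ * n →
    c₂ * ((cosetWeight (dualCode Q.CX) y : ℝ) / n) ≤ (hammingNorm (Q.HZ.mulVec y) : ℝ) / mZ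

/-- `(c₁, c₂)`-small-set coboundary expansion. -/
def SmallSetCoboundaryExpansion (Q : CSSCode n mX mZ) (c₁ c₂ : ℝ) : Prop :=
  ∀ y : Fin n → ZMod 2, (hammingNorm y : ℝ) ≤ c₁ * n →
    c₂ * ((cosetWeight (dualCode Q.CZ) y : ℝ) / n) ≤ (hammingNorm (Q.HX.mulVec y) : ℝ) / mX

end CSSCode

/-! ## Qubit systems -/

/-- Operators on the qubits indexed by `ι`, as matrices in the computational basis
`|x⟩`, `x : ι → ZMod 2`. -/
abbrev Op (ι : Type) : Type := Matrix (ι → ZMod 2) (ι → ZMod 2) ℂ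

section Qubits

variable {ι : Type} [Fintype ι] [DecidableEq ι]

/-- A (possibly mixed) state: a density matrix. -/
def IsState (ρ : Op ι) : Prop := ρ.PosSemidef ∧ ρ.trace = 1

/-- `X^a |y⟩ = |y + a⟩`. -/
def pauliX (a : ι → ZMod 2) : Op ι :=
  Matrix.of fun x y => if x = y + a then 1 else 0

/-- `Z^a |y⟩ = (-1)^(a · y) |y⟩`. -/
def pauliZ (a : ι → ZMod 2) : Op ι :=
  Matrix.diagonal fun y => (-1 : ℂ) ^ (a ⬝ᵥ y).val

/-- The operator `u ⊗ I` that applies `u` to the qubits in `S` and the identity to the others. -/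
def localOp (S : Finset ι) (u : Op S) : Op ι :=
  Matrix.of fun x y =>
    if ∀ i, i ∉ S → x i = y i then u (fun i => x i) (fun i => y i) else 0

/-- `H` is a sum of Hamiltonians, each acting nontrivially on at most `ℓ` qubits. -/
def IsLocalHamiltonian (ℓ : ℕ) (H : Op ι) : Prop :=
  ∃ (N : ℕ) (S : Fin N → Finset ι) (h : (i : Fin N) → Op (S i)),
    (∀ i, (S i).card ≤ ℓ) ∧ (∀ i, (h i).IsHermitian) ∧ H = ∑ i, localOp (S i) (h i)

/-- `ρ` is an `ε`-approximate ground state of `H`: a state with `Tr(ρ H) ≤ ε`. -/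
def IsApproxGroundState (H : Op ι) (ε : ℝ) (ρ : Op ι) : Prop :=
  IsState ρ ∧ (Matrix.trace (ρ * H)).re ≤ ε

end Qubits

/-- The code Hamiltonian `H = (H_X + H_Z) / 2`, where `H_X` is the average of `(I - X^y) / 2` over
the rows `y` of the first parity-check matrix and `H_Z` is the average of `(I - Z^y) / 2` over the
rows `y` of the second one. -/
def CSSCode.hamiltonian {n mX mZ : ℕ} (Q : CSSCode n mX mZ) : Op (Fin n) :=
  (1 / 2 : ℂ) •
    ((1 / (mX : ℂ)) • ∑ i, (1 / 2 : ℂ) • (1 - pauliX (Q.HX i)) +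
     (1 / (mZ : ℂ)) • ∑ i, (1 / 2 : ℂ) • (1 - pauliZ (Q.HZ i)))

/-! ## Quantum circuits -/

/-- A gate: an arbitrary unitary on at most two qubits. -/
structure Gate (ι : Type) [Fintype ι] [DecidableEq ι] where
  support : Finset ι
  card_le : support.card ≤ 2
  mat : Op support
  unitary : mat ∈ Matrix.unitaryGroup (support → ZMod 2) ℂ

/-- A layer: gates acting on pairwise disjoint sets of qubits. -/
structure Layer (ι : Type) [Fintype ι] [DecidableEq ι] where
  gates : List (Gate ι)
  disjoint : gates.Pairwise fun g h => Disjoint g.support h.support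

/-- The unitary implemented by a layer. -/
def Layer.toOp {ι : Type} [Fintype ι] [DecidableEq ι] (L : Layer ι) : Op ι :=
  (L.gates.map fun g => localOp g.support g.mat).prod

/-- A circuit: a sequence of layers, the head of the list being applied first. -/
abbrev Circuit (ι : Type) [Fintype ι] [DecidableEq ι] : Type := List (Layer ι)

/-- The depth of a circuit: its number of layers. -/
def Circuit.depth {ι : Type} [Fintype ι] [DecidableEq ι] (C : Circuit ι) : ℕ := C.length

/-- The unitary implemented by a circuit. -/
def Circuit.toOp {ι : Type} [Fintype ι] [DecidableEq ι] : Circuit ι → Op ι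
  | [] => 1
  | L :: C => Circuit.toOp C * L.toOp

/-- The pure state vector obtained by applying a circuit to the all-zero basis state. -/
def Circuit.outputVec {ι : Type} [Fintype ι] [DecidableEq ι] (C : Circuit ι) :
    (ι → ZMod 2) → ℂ :=
  (Circuit.toOp C).mulVec (Pi.single 0 1)

/-- The `n`-qubit state left when a circuit on `n + a` qubits is applied to the all-zero state and
the `a` ancilla qubits are traced out. -/
def Circuit.outputState {n a : ℕ} (C : Circuit (Fin n ⊕ Fin a)) : Op (Fin n) :=
  Matrix.of fun x y => ∑ z : Fin a → ZMod 2,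
    Circuit.outputVec C (Sum.elim x z) * star (Circuit.outputVec C (Sum.elim y z))

/-! ## NLTS Hamiltonians -/

/-- The minimum depth of a circuit, on at least `n` qubits, that constructs an `ε`-approximate
ground state of `H`. -/
def minDepth {n : ℕ} (H : Op (Fin n)) (ε : ℝ) : ℕ∞ :=
  sInf {t : ℕ∞ | ∃ (a : ℕ) (C : Circuit (Fin n ⊕ Fin a)),
    IsApproxGroundState H ε (Circuit.outputState C) ∧ t = (Circuit.depth C : ℕ∞)}

/-- A family of local Hamiltonians `0 ≤ H j ≤ I`, with `H j` on `n j` qubits, is NLTS if for some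
`ε > 0` the minimum depth of a circuit constructing an `ε`-approximate ground state of `H j`
tends to infinity. -/
def IsNLTS (n : ℕ → ℕ) (H : (j : ℕ) → Op (Fin (n j))) : Prop :=
  (∃ ℓ : ℕ, ∀ j, IsLocalHamiltonian ℓ (H j)) ∧
  (∀ j, (H j).PosSemidef ∧ (1 - H j).PosSemidef) ∧
  ∃ ε : ℝ, 0 < ε ∧ Tendsto (fun j => minDepth (H j) ε) atTop (𝓝 ⊤)

end NLTS

end

/-!
Measured in the `X` or in the `Z` basis, a low-energy state violates few checks with high
probability. By clustering, two words violating few checks are either close modulo stabilizers or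
far apart, so the measured words fall into clusters at pairwise distance at least `c₂ n`.

If the outcome in one of the two bases is not concentrated on a single cluster, two sets of words at
distance `c₂ n` have constant probability, so the function "distance to the first set" has variance
of order `n²`. In the output of a circuit `U` of depth `t`, every `1`-Lipschitz function `f` has
variance at most `n 4 ^ t`. Indeed, the variance is the squared norm of the part of
`U⋆ f U |0⟩` orthogonal to `|0⟩`, and for its component with qubit `i` flipped `f` may be replaced
by its difference to a function that ignores the light cone of `i`, which is bounded by the size of
that light cone. A layer of Hadamard gates spreads no operator, so the basis does not matter.

If both outcomes are concentrated on a single cluster, then a cluster has diameter less than the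
distance of the code, so the syndrome of a word in it determines the word modulo stabilizers.
Decoding followed by an anticommuting pair of logical operators gives two anticommuting observables
of square `1` with expectations close to `1`, which the uncertainty relation excludes.

Small-set expansion implies both clustering and linear distance: a representative of least weight
of the coset of `y` is either large or expands.
-/

noncomputable section

namespace NLTS

open Matrix

/-! ### Signs and Pauli operators -/

/-- The sign character `a ↦ (-1)^a` of a bit. -/
def sgn : AddChar (ZMod 2) ℝ := AddChar.zmodChar 2 (neg_one_sq (R := ℝ))

@[simp] lemma sgn_one : sgn 1 = -1 := by
  simp [sgn, AddChar.zmodChar_apply, ZMod.val_one]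

lemma bit_eq_one_of_ne_zero {a : ZMod 2} (ha : a ≠ 0) : a = 1 := Fin.eq_one_of_ne_zero a ha

lemma sgn_mul_self (a : ZMod 2) : sgn a * sgn a = 1 := by
  rw [← AddChar.map_add_eq_mul, ZModModule.add_self, AddChar.map_zero_eq_one]

lemma one_sub_sgn_div_two (a : ZMod 2) : (1 - sgn a) / 2 = if a ≠ 0 then 1 else 0 := by
  split_ifs with ha
  · norm_num [bit_eq_one_of_ne_zero ha]
  · norm_num [not_not.1 ha]

section Pauli

variable {ι : Type} [Fintype ι] [DecidableEq ι]

/-- The diagonal operators, as a homomorphism from the real functions on the computational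
basis. -/
def diagOp : ((ι → ZMod 2) → ℝ) →+* Op ι :=
  (Matrix.diagonalRingHom _ ℂ).comp (Complex.ofRealHom.compLeft _)

lemma diagOp_eq_diagonal (f : (ι → ZMod 2) → ℝ) :
    diagOp f = Matrix.diagonal fun x => (f x : ℂ) := rfl

lemma diagOp_mul_apply (f : (ι → ZMod 2) → ℝ) (A : Op ι) (x y : ι → ZMod 2) :
    (diagOp f * A) x y = f x * A x y :=
  Matrix.diagonal_mul _ _ _ _

lemma mul_diagOp_apply (A : Op ι) (f : (ι → ZMod 2) → ℝ) (x y : ι → ZMod 2) :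
    (A * diagOp f) x y = A x y * f y :=
  Matrix.mul_diagonal _ _ _ _

lemma isHermitian_diagOp (f : (ι → ZMod 2) → ℝ) : (diagOp f).IsHermitian :=
  Matrix.isHermitian_diagonal_of_self_adjoint _ (funext fun x => Complex.conj_ofReal (f x))

lemma pauliZ_eq_diagOp (a : ι → ZMod 2) : pauliZ a = diagOp fun y => sgn (a ⬝ᵥ y) := by
  simp [pauliZ, diagOp_eq_diagonal, sgn, AddChar.zmodChar_apply]

lemma mul_pauliX_apply (A : Op ι) (v x y : ι → ZMod 2) :
    (A * pauliX v) x y = A x (y + v) := by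
  simp [Matrix.mul_apply, pauliX]

end Pauli

/-! ### Local operators -/

section LocalOp

variable {ι : Type} [Fintype ι] [DecidableEq ι]

open scoped Kronecker in
lemma localOp_eq_submatrix (S : Finset ι) (u : Op S) :
    localOp S u =
      (u ⊗ₖ (1 : Matrix ({i // i ∉ S} → ZMod 2) ({i // i ∉ S} → ZMod 2) ℂ)).submatrix
        (Equiv.piEquivPiSubtypeProd (· ∈ S) fun _ => ZMod 2)
        (Equiv.piEquivPiSubtypeProd (· ∈ S) fun _ => ZMod 2) := by
  ext x y
  simp [localOp, Matrix.kroneckerMap_apply, Matrix.one_apply, funext_iff]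

lemma localOp_one (S : Finset ι) : localOp S (1 : Op S) = 1 := by
  rw [localOp_eq_submatrix, Matrix.one_kronecker_one, Matrix.submatrix_one_equiv]

/-- `localOp` as a homomorphism of star algebras. -/
def localOpHom (S : Finset ι) : Op S →⋆ₐ[ℂ] Op ι where
  toFun := localOp S
  map_one' := localOp_one S
  map_mul' u v := by
    simp only [localOp_eq_submatrix, Matrix.submatrix_mul_equiv, ← Matrix.mul_kronecker_mul,
      one_mul]
  map_zero' := by
    simp only [localOp_eq_submatrix, Matrix.zero_kronecker, Matrix.submatrix_zero]
    rfl
  map_add' u v := by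
    simp only [localOp_eq_submatrix, Matrix.add_kronecker, Matrix.submatrix_add]
    rfl
  commutes' c := by
    rw [Algebra.algebraMap_eq_smul_one, Algebra.algebraMap_eq_smul_one, ← localOp_one S]
    simp only [localOp_eq_submatrix, Matrix.smul_kronecker, Matrix.submatrix_smul]
    rfl
  map_star' u := by
    simp only [Matrix.star_eq_conjTranspose, localOp_eq_submatrix, Matrix.conjTranspose_submatrix,
      Matrix.conjTranspose_kronecker, Matrix.conjTranspose_one]

lemma localOpHom_apply (S : Finset ι) (u : Op S) : localOpHom S u = localOp S u := rfl

lemma localOp_mem_unitaryGroup (S : Finset ι) {u : Op S}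
    (hu : u ∈ Matrix.unitaryGroup (S → ZMod 2) ℂ) :
    localOp S u ∈ Matrix.unitaryGroup (ι → ZMod 2) ℂ :=
  Unitary.map_mem (localOpHom S) hu

lemma localOp_diagOp (S : Finset ι) (g : (S → ZMod 2) → ℝ) :
    localOp S (diagOp g) = diagOp fun x : ι → ZMod 2 => g fun i => x i := by
  ext x y
  have hxy : x = y ↔ (∀ i, i ∉ S → x i = y i) ∧ (fun i : S => x i) = fun i : S => y i := by
    simp only [funext_iff, Subtype.forall, ← forall_and]
    exact forall_congr' fun i => by tauto
  simp only [localOp, diagOp_eq_diagonal, Matrix.of_apply, Matrix.diagonal_apply, hxy, ite_and]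

lemma commute_localOp_localOp {S T : Finset ι} (hST : Disjoint S T) (u : Op S) (v : Op T) :
    Commute (localOp S u) (localOp T v) := by
  ext x y
  rw [Matrix.mul_apply, Matrix.mul_apply]
  -- The path `x → z → y` in one order of the factors corresponds to `x → x + y + z → y` in the
  -- other.
  refine Fintype.sum_equiv (Equiv.addLeft (x + y)) _ _ fun z => ?_
  have hxw (i : ι) : x i = (x + y + z) i ↔ z i = y i :=
    (by decide : ∀ a b c : ZMod 2, a = a + b + c ↔ c = b) (x i) (y i) (z i)
  have hwy (i : ι) : (x + y + z) i = y i ↔ x i = z i :=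
    (by decide : ∀ a b c : ZMod 2, a + b + c = b ↔ a = c) (x i) (y i) (z i)
  simp only [localOp, Matrix.of_apply, Equiv.coe_addLeft, hxw, hwy]
  by_cases hxz : ∀ i, i ∉ S → x i = z i
  swap
  · rw [if_neg hxz, if_neg hxz, zero_mul, mul_zero]
  by_cases hzy : ∀ i, i ∉ T → z i = y i
  swap
  · rw [if_neg hzy, if_neg hzy, zero_mul, mul_zero]
  have hS (i : S) : z i = y i := hzy i (Finset.disjoint_left.1 hST i.2)
  have hT (i : T) : x i = z i := hxz i (Finset.disjoint_right.1 hST i.2)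
  simp only [if_pos hxz, if_pos hzy, ← (hxw _).2 (hS _), (hwy _).2 (hT _), hS, hT, mul_comm]

/-- The operators that act as the identity on all qubits outside `S`, encoded as the commutant of
the operators on qubits outside `S`. -/
def supportedOn (S : Set ι) : Subalgebra ℂ (Op ι) :=
  Subalgebra.centralizer ℂ {B | ∃ (T : Finset ι) (v : Op T), Disjoint S T ∧ localOp T v = B}

lemma commute_localOp_of_mem_supportedOn {S : Set ι} {A : Op ι} (hA : A ∈ supportedOn S)
    {T : Finset ι} (hST : Disjoint S T) (v : Op T) : Commute (localOp T v) A :=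
  (Subalgebra.mem_centralizer_iff ℂ).1 hA _ ⟨T, v, hST, rfl⟩

lemma supportedOn_mono {S T : Set ι} (h : S ⊆ T) : supportedOn S ≤ supportedOn T :=
  Subalgebra.centralizer_le ℂ _ _ fun _ ⟨R, v, hR, hB⟩ => ⟨R, v, hR.mono_left h, hB⟩

lemma localOp_mem_supportedOn (S : Finset ι) (u : Op S) :
    localOp S u ∈ supportedOn (S : Set ι) := by
  rw [supportedOn, Subalgebra.mem_centralizer_iff]
  rintro _ ⟨T, v, hST, rfl⟩
  exact (commute_localOp_localOp (Finset.disjoint_coe.1 hST) u v).symm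

lemma commute_diagOp_of_mem_supportedOn {S : Set ι} {A : Op ι} (hA : A ∈ supportedOn S)
    {g : (ι → ZMod 2) → ℝ} (hg : ∀ x y, (∀ j ∉ S, x j = y j) → g x = g y) :
    Commute (diagOp g) A := by
  classical
  set T : Finset ι := Finset.univ.filter (· ∉ S) with hT
  have hg' : diagOp g =
      localOp T (diagOp fun x => g fun i => if hi : i ∈ T then x ⟨i, hi⟩ else 0) := by
    rw [localOp_diagOp]
    refine congrArg diagOp (funext fun x => hg _ _ fun j hj => ?_)
    simp [hT, hj]
  rw [hg']
  exact commute_localOp_of_mem_supportedOn hA (Set.disjoint_left.2 fun i hi => by simp [hT, hi]) _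

/-- The set of nonzero positions of a bit vector: the qubits on which the Pauli operators with this
exponent act. -/
def bitSupport (a : ι → ZMod 2) : Finset ι := Finset.univ.filter fun i => a i ≠ 0

omit [DecidableEq ι] in
lemma eq_zero_of_notMem_bitSupport {a : ι → ZMod 2} {i : ι} (hi : i ∉ bitSupport a) : a i = 0 := by
  simpa [bitSupport] using hi

lemma localOp_pauliX (a : ι → ZMod 2) :
    localOp (bitSupport a) (pauliX fun i => a i) = pauliX a := by
  ext x y
  have hxy : x = y + a ↔ (∀ i, i ∉ bitSupport a → x i = y i) ∧
      (fun i : bitSupport a => x i) =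
        (fun i : bitSupport a => y i) + fun i : bitSupport a => a i := by
    simp only [funext_iff, Subtype.forall, ← forall_and, Pi.add_apply]
    refine forall_congr' fun i => ?_
    by_cases hi : i ∈ bitSupport a
    · simp [hi]
    · simp [hi, eq_zero_of_notMem_bitSupport hi]
  simp only [localOp, pauliX, Matrix.of_apply, hxy, ite_and]

lemma localOp_pauliZ (a : ι → ZMod 2) :
    localOp (bitSupport a) (pauliZ fun i => a i) = pauliZ a := by
  rw [pauliZ_eq_diagOp, pauliZ_eq_diagOp, localOp_diagOp]
  refine congrArg diagOp (funext fun y => congrArg sgn ?_)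
  rw [dotProduct, Finset.sum_coe_sort (bitSupport a) fun i => a i * y i]
  refine Finset.sum_subset (Finset.subset_univ _) fun i _ hi => ?_
  rw [eq_zero_of_notMem_bitSupport hi, zero_mul]

lemma pauliZ_mem_supportedOn {a : ι → ZMod 2} {S : Set ι} (ha : ∀ i ∉ S, a i = 0) :
    pauliZ a ∈ supportedOn S := by
  rw [← localOp_pauliZ]
  refine supportedOn_mono (fun i hi => ?_) (localOp_mem_supportedOn _ _)
  by_contra hiS
  simp [bitSupport, ha i hiS] at hi

end LocalOp

/-! ### Light cones -/

section Relations

variable {α β γ : Type*}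

lemma ncard_setOf_comp_le [Finite β] {r : α → β → Prop} {s : β → γ → Prop} {d e : ℕ}
    (hr : ∀ i, {j | r i j}.ncard ≤ d) (hs : ∀ j, {k | s j k}.ncard ≤ e) (i : α) :
    {k | Relation.Comp r s i k}.ncard ≤ d * e := by
  classical
  have := Fintype.ofFinite β
  have hunion : {k | Relation.Comp r s i k} = ⋃ j ∈ {j | r i j}.toFinset, {k | s j k} := by
    ext k
    simp [Relation.Comp]
  calc {k | Relation.Comp r s i k}.ncard
      ≤ ∑ j ∈ {j | r i j}.toFinset, {k | s j k}.ncard := by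
        rw [hunion]
        exact Finset.set_ncard_biUnion_le _ _
    _ ≤ {j | r i j}.toFinset.card * e := Finset.sum_le_card_nsmul _ _ _ fun j _ => hs j
    _ ≤ d * e := by
        rw [← Set.ncard_eq_toFinset_card']
        exact Nat.mul_le_mul_right e (hr i)

lemma sum_ncard_sq_le [Fintype α] [Fintype β] {r : α → β → Prop} {d : ℕ}
    (hrow : ∀ i, {j | r i j}.ncard ≤ d) (hcol : ∀ j, {i | r i j}.ncard ≤ d) :
    ∑ i, {j | r i j}.ncard ^ 2 ≤ Fintype.card β * d ^ 2 := by
  classical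
  have hcard (i : α) : {j | r i j}.ncard = ∑ j, if r i j then 1 else 0 := by
    rw [Set.ncard_eq_toFinset_card', Set.toFinset_ofPred, Finset.card_filter]
  have hcard' (j : β) : {i | r i j}.ncard = ∑ i, if r i j then 1 else 0 := by
    rw [Set.ncard_eq_toFinset_card', Set.toFinset_ofPred, Finset.card_filter]
  calc ∑ i, {j | r i j}.ncard ^ 2
      ≤ ∑ i, d * {j | r i j}.ncard :=
        Finset.sum_le_sum fun i _ => by rw [sq]; exact Nat.mul_le_mul_right _ (hrow i)
    _ = ∑ j, d * {i | r i j}.ncard := by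
        simp only [hcard, hcard', ← Finset.mul_sum]
        rw [Finset.sum_comm]
    _ ≤ ∑ _j : β, d * d := Finset.sum_le_sum fun j _ => Nat.mul_le_mul_left _ (hcol j)
    _ = Fintype.card β * d ^ 2 := by rw [Finset.sum_const, Finset.card_univ, smul_eq_mul, sq]

end Relations

section LightCone

variable {ι : Type} [Fintype ι] [DecidableEq ι]

/-- The unitary implemented by a gate. -/
def Gate.toOp (g : Gate ι) : Op ι := localOp g.support g.mat

/-- The unitary implemented by a list of gates, those of a layer in particular. -/
def gatesOp (l : List (Gate ι)) : Op ι := (l.map Gate.toOp).prod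

/-- Two qubits are adjacent for a list of gates if they are equal or acted on by a common gate. -/
def Adj (l : List (Gate ι)) (i j : ι) : Prop :=
  i = j ∨ ∃ g ∈ l, i ∈ g.support ∧ j ∈ g.support

/-- The qubit `j` lies in the forward light cone of the qubit `i`. -/
def Circuit.Reach : Circuit ι → ι → ι → Prop
  | [] => Eq
  | L :: C => Relation.Comp (Adj L.gates) (Circuit.Reach C)

lemma Gate.toOp_mem_unitaryGroup (g : Gate ι) :
    g.toOp ∈ Matrix.unitaryGroup (ι → ZMod 2) ℂ :=
  localOp_mem_unitaryGroup _ g.unitary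

lemma gatesOp_mem_unitaryGroup (l : List (Gate ι)) :
    gatesOp l ∈ Matrix.unitaryGroup (ι → ZMod 2) ℂ :=
  list_prod_mem (List.forall_mem_map.2 fun g _ => g.toOp_mem_unitaryGroup)

lemma Circuit.toOp_mem_unitaryGroup (C : Circuit ι) :
    C.toOp ∈ Matrix.unitaryGroup (ι → ZMod 2) ℂ := by
  induction C with
  | nil => exact one_mem _
  | cons L C ih => exact mul_mem ih (gatesOp_mem_unitaryGroup L.gates)

lemma Adj.symm {l : List (Gate ι)} {i j : ι} : Adj l i j → Adj l j i
  | .inl h => .inl h.symm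
  | .inr ⟨g, hg, hi, hj⟩ => .inr ⟨g, hg, hj, hi⟩

lemma Gate.conj_eq_self (g : Gate ι) {S : Set ι} {A : Op ι} (hA : A ∈ supportedOn S)
    (hS : Disjoint S g.support) : g.toOp * A * star g.toOp = A := by
  rw [Gate.toOp, (commute_localOp_of_mem_supportedOn hA hS g.mat).eq, mul_assoc, ← Gate.toOp,
    Unitary.mul_star_self_of_mem g.toOp_mem_unitaryGroup, mul_one]

lemma Gate.conj_mem_supportedOn (g : Gate ι) {S : Set ι} {A : Op ι} (hA : A ∈ supportedOn S)
    (hS : ↑g.support ⊆ S) : g.toOp * A * star g.toOp ∈ supportedOn S := by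
  have hstar : star g.toOp = localOp g.support (star g.mat) :=
    (map_star (localOpHom g.support) g.mat).symm
  rw [hstar]
  exact mul_mem (mul_mem (supportedOn_mono hS (localOp_mem_supportedOn _ _)) hA)
    (supportedOn_mono hS (localOp_mem_supportedOn _ _))

lemma Adj.cons {g : Gate ι} {l : List (Gate ι)} {i j : ι} (h : Adj l i j) : Adj (g :: l) i j :=
  h.imp_right fun ⟨g', hg', hij⟩ => ⟨g', List.mem_cons_of_mem _ hg', hij⟩

lemma gatesOp_conj_mem_supportedOn (l : List (Gate ι))
    (hl : l.Pairwise fun g h => Disjoint g.support h.support) {S : Set ι} {A : Op ι}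
    (hA : A ∈ supportedOn S) :
    gatesOp l * A * star (gatesOp l) ∈ supportedOn {j | ∃ i ∈ S, Adj l i j} := by
  induction l with
  | nil => simpa [gatesOp, Adj] using hA
  | cons g l ih =>
    obtain ⟨hgl, hl⟩ := List.pairwise_cons.1 hl
    have hcons : gatesOp (g :: l) * A * star (gatesOp (g :: l)) =
        g.toOp * (gatesOp l * A * star (gatesOp l)) * star g.toOp := by
      simp only [gatesOp, List.map_cons, List.prod_cons, star_mul, mul_assoc]
    have hmono : {j | ∃ i ∈ S, Adj l i j} ⊆ {j | ∃ i ∈ S, Adj (g :: l) i j} :=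
      fun j ⟨i, hi, hij⟩ => ⟨i, hi, hij.cons⟩
    rw [hcons]
    by_cases hgS : ∃ i ∈ S, i ∈ g.support
    · obtain ⟨i, hi, hig⟩ := hgS
      exact g.conj_mem_supportedOn (supportedOn_mono hmono (ih hl)) fun j hj =>
        ⟨i, hi, .inr ⟨g, List.mem_cons_self, hig, hj⟩⟩
    · rw [g.conj_eq_self (ih hl)]
      · exact supportedOn_mono hmono (ih hl)
      · refine Set.disjoint_left.2 ?_
        rintro j ⟨i, hi, rfl | ⟨g', hg', -, hj'⟩⟩ hj
        · exact hgS ⟨i, hi, hj⟩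
        · exact Finset.disjoint_left.1 (hgl g' hg') hj hj'

lemma Circuit.conj_mem_supportedOn (C : Circuit ι) {S : Set ι} {A : Op ι}
    (hA : A ∈ supportedOn S) :
    C.toOp * A * star C.toOp ∈ supportedOn {j | ∃ i ∈ S, C.Reach i j} := by
  induction C generalizing S A with
  | nil => simpa [Circuit.toOp, Circuit.Reach] using hA
  | cons L C ih =>
    have hcons : Circuit.toOp (L :: C) * A * star (Circuit.toOp (L :: C)) =
        Circuit.toOp C * (gatesOp L.gates * A * star (gatesOp L.gates)) *
          star (Circuit.toOp C) := by
      rw [Circuit.toOp, star_mul]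
      simp only [mul_assoc]
      rfl
    rw [hcons]
    refine supportedOn_mono ?_ (ih (gatesOp_conj_mem_supportedOn L.gates L.disjoint hA))
    rintro j ⟨k, ⟨i, hi, hik⟩, hkj⟩
    exact ⟨i, hi, k, hik, hkj⟩

lemma Layer.ncard_setOf_adj_le (L : Layer ι) (i : ι) : {j | Adj L.gates i j}.ncard ≤ 2 := by
  by_cases h : ∃ g ∈ L.gates, i ∈ g.support
  · obtain ⟨g, hg, hi⟩ := h
    refine (Set.ncard_le_ncard (t := g.support) ?_).trans ?_
    · rintro j (rfl | ⟨g', hg', hi', hj⟩)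
      · exact hi
      · obtain rfl : g = g' := by
          by_contra hne
          have : Std.Symm fun g h : Gate ι => Disjoint g.support h.support := ⟨fun _ _ h => h.symm⟩
          exact Finset.disjoint_left.1 (L.disjoint.forall hg hg' hne) hi hi'
        exact hj
    · rw [Set.ncard_coe_finset]
      exact g.card_le
  · have : {j | Adj L.gates i j} = {i} := by
      ext j
      simp only [Adj]
      grind
    rw [this, Set.ncard_singleton]
    exact one_le_two

lemma Circuit.ncard_forwardCone_le (C : Circuit ι) (i : ι) :
    {j | C.Reach i j}.ncard ≤ 2 ^ C.depth := by
  induction C generalizing i with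
  | nil => simp [Circuit.Reach, Circuit.depth]
  | cons L C ih =>
    simpa only [Circuit.Reach, Circuit.depth, List.length_cons, pow_succ'] using
      ncard_setOf_comp_le L.ncard_setOf_adj_le ih i

lemma Circuit.ncard_backwardCone_le (C : Circuit ι) (j : ι) :
    {i | C.Reach i j}.ncard ≤ 2 ^ C.depth := by
  induction C generalizing j with
  | nil => simp [Circuit.Reach, Circuit.depth]
  | cons L C ih =>
    have hflip : {i | Circuit.Reach (L :: C) i j} =
        {i | Relation.Comp (flip (Circuit.Reach C)) (Adj L.gates) j i} := by
      ext i
      exact ⟨fun ⟨k, hik, hkj⟩ => ⟨k, hkj, hik.symm⟩, fun ⟨k, hkj, hik⟩ => ⟨k, hik.symm, hkj⟩⟩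
    rw [hflip]
    simpa only [Circuit.depth, List.length_cons, pow_succ] using
      ncard_setOf_comp_le (r := flip (Circuit.Reach C)) ih L.ncard_setOf_adj_le j

end LightCone

/-! ### The Hadamard transform -/

section Hadamard

variable {ι : Type} [Fintype ι] [DecidableEq ι]

/-- The tensor product of the Hadamard gates on all qubits. -/
def hadamard : Op ι :=
  Matrix.of fun x y => ∏ i, (((√2)⁻¹ * sgn (x i * y i) : ℝ) : ℂ)

omit [DecidableEq ι] in
lemma hadamard_apply (x y : ι → ZMod 2) :
    hadamard x y = ∏ i, (((√2)⁻¹ * sgn (x i * y i) : ℝ) : ℂ) := rfl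

omit [DecidableEq ι] in
lemma sgn_dotProduct (x y : ι → ZMod 2) : sgn (x ⬝ᵥ y) = ∏ i, sgn (x i * y i) :=
  map_prod sgn.toMonoidHom (fun i => Multiplicative.ofAdd (x i * y i)) Finset.univ

omit [DecidableEq ι] in
lemma hadamard_symm (x y : ι → ZMod 2) : hadamard x y = hadamard y x := by
  simp only [hadamard_apply, mul_comm (x _)]

omit [DecidableEq ι] in
lemma hadamard_conjTranspose : (hadamard : Op ι)ᴴ = hadamard := by
  ext x y
  rw [Matrix.conjTranspose_apply, hadamard_symm]
  simp only [hadamard_apply, star_prod, RCLike.star_def, Complex.conj_ofReal]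

lemma sum_hadamardGate_mul (a c : ZMod 2) :
    ∑ b : ZMod 2, (√2)⁻¹ * sgn (a * b) * ((√2)⁻¹ * sgn (b * c)) = if a = c then 1 else 0 := by
  have hsq : (√2)⁻¹ * (√2)⁻¹ = (2 : ℝ)⁻¹ := by
    rw [← mul_inv, Real.mul_self_sqrt zero_le_two]
  have hterm (b : ZMod 2) :
      (√2)⁻¹ * sgn (a * b) * ((√2)⁻¹ * sgn (b * c)) = 2⁻¹ * sgn (b * (a + c)) := by
    rw [mul_mul_mul_comm, hsq, ← AddChar.map_add_eq_mul, mul_comm a, ← mul_add]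
  rw [Finset.sum_congr rfl fun b _ => hterm b, ← Finset.mul_sum,
    show (Finset.univ : Finset (ZMod 2)) = {0, 1} from rfl, Finset.sum_pair zero_ne_one, zero_mul,
    one_mul, AddChar.map_zero_eq_one]
  split_ifs with hac
  · norm_num [hac, ZModModule.add_self]
  · have hone : a + c = 1 := bit_eq_one_of_ne_zero (by rwa [← ZModModule.sub_eq_add, sub_ne_zero])
    norm_num [hone]

lemma hadamard_mul_self : (hadamard : Op ι) * hadamard = 1 := by
  ext x y
  simp only [Matrix.mul_apply, hadamard_apply, ← Finset.prod_mul_distrib, ← Complex.ofReal_mul]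
  have h := Finset.prod_univ_sum (fun _ : ι => (Finset.univ : Finset (ZMod 2)))
    fun i b => ((√2)⁻¹ * sgn (x i * b) * ((√2)⁻¹ * sgn (b * y i)) : ℝ)
  simp only [Fintype.piFinset_univ, sum_hadamardGate_mul] at h
  simp only [← Complex.ofReal_prod, ← Complex.ofReal_sum, ← h, Matrix.one_apply, Fintype.prod_boole]
  simp [funext_iff, apply_ite]

lemma hadamard_mem_unitaryGroup : hadamard ∈ Matrix.unitaryGroup (ι → ZMod 2) ℂ := by
  rw [Matrix.mem_unitaryGroup_iff, Matrix.star_eq_conjTranspose, hadamard_conjTranspose,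
    hadamard_mul_self]

/-- Conjugation by the Hadamard gates, which exchanges the Pauli operators `X` and `Z`. -/
def hadamardConj : Op ι ≃⋆ₐ[ℂ] Op ι :=
  Unitary.conjStarAlgAut ℂ (Op ι) ⟨hadamard, hadamard_mem_unitaryGroup⟩

lemma hadamardConj_apply (A : Op ι) : hadamardConj A = hadamard * A * hadamard := by
  rw [hadamardConj, Unitary.conjStarAlgAut_apply]
  exact congrArg (hadamard * A * ·) hadamard_conjTranspose

lemma hadamardConj_hadamardConj (A : Op ι) : hadamardConj (hadamardConj A) = A := by
  rw [hadamardConj_apply, hadamardConj_apply, mul_assoc, mul_assoc, hadamard_mul_self, mul_one,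
    ← mul_assoc, hadamard_mul_self, one_mul]

lemma hadamardConj_pauliZ (v : ι → ZMod 2) : hadamardConj (pauliZ v) = pauliX v := by
  have hcomm : pauliZ v * hadamard = hadamard * pauliX v := by
    ext x y
    rw [mul_pauliX_apply, pauliZ_eq_diagOp, diagOp_mul_apply, sgn_dotProduct, hadamard_apply,
      hadamard_apply, Complex.ofReal_prod, ← Finset.prod_mul_distrib]
    refine Finset.prod_congr rfl fun i _ => ?_
    rw [Pi.add_apply, mul_add, AddChar.map_add_eq_mul, mul_comm (x i) (v i)]
    push_cast
    ring
  rw [hadamardConj_apply, mul_assoc, hcomm, ← mul_assoc, hadamard_mul_self, one_mul]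

open scoped Kronecker in
lemma hadamard_eq_submatrix (S : Finset ι) :
    (hadamard : Op ι) =
      ((hadamard : Op S) ⊗ₖ (hadamard : Op {i // i ∉ S})).submatrix
        (Equiv.piEquivPiSubtypeProd (· ∈ S) fun _ => ZMod 2)
        (Equiv.piEquivPiSubtypeProd (· ∈ S) fun _ => ZMod 2) := by
  ext x y
  simp only [Matrix.submatrix_apply, Matrix.kroneckerMap_apply, hadamard_apply]
  convert (Fintype.prod_subtype_mul_prod_subtype (· ∈ S)
    fun i => (((√2)⁻¹ * sgn (x i * y i) : ℝ) : ℂ)).symm <;> rfl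

lemma hadamardConj_localOp (S : Finset ι) (u : Op S) :
    hadamardConj (localOp S u) = localOp S (hadamardConj u) := by
  rw [hadamardConj_apply, hadamardConj_apply, localOp_eq_submatrix, localOp_eq_submatrix,
    hadamard_eq_submatrix S, Matrix.submatrix_mul_equiv, Matrix.submatrix_mul_equiv,
    ← Matrix.mul_kronecker_mul, ← Matrix.mul_kronecker_mul, mul_one, hadamard_mul_self]

lemma hadamardConj_mem_supportedOn {S : Set ι} {A : Op ι} (hA : A ∈ supportedOn S) :
    hadamardConj A ∈ supportedOn S := by
  rw [supportedOn, Subalgebra.mem_centralizer_iff]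
  rintro _ ⟨T, v, hST, rfl⟩
  rw [← hadamardConj_hadamardConj v, ← hadamardConj_localOp]
  exact (commute_localOp_of_mem_supportedOn hA hST _).map hadamardConj

end Hadamard

/-! ### A Poincaré inequality for small light cones -/

section Variance

variable {κ : Type*} [Fintype κ]

/-- The variance of the function `f` of a point drawn from the distribution `p`. -/
def variance (p f : κ → ℝ) : ℝ := ∑ x, p x * f x ^ 2 - (∑ x, p x * f x) ^ 2

lemma variance_eq_sum_mul_sub_sq {p : κ → ℝ} (hp1 : ∑ x, p x = 1) (f : κ → ℝ) :
    variance p f = ∑ x, p x * (f x - ∑ y, p y * f y) ^ 2 := by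
  set m := ∑ y, p y * f y with hm
  have hterm (x : κ) : p x * (f x - m) ^ 2 = p x * f x ^ 2 - 2 * m * (p x * f x) + m ^ 2 * p x := by
    ring
  simp only [hterm, Finset.sum_add_distrib, Finset.sum_sub_distrib, ← Finset.mul_sum, hp1, ← hm,
    variance]
  ring

lemma le_variance_of_two_values {p f : κ → ℝ} (hp : ∀ x, 0 ≤ p x) (hp1 : ∑ x, p x = 1)
    {S T : Finset κ} (hST : Disjoint S T) {c D μ : ℝ} (hμ : 0 ≤ μ)
    (hfS : ∀ x ∈ S, f x = c) (hfT : ∀ x ∈ T, f x = c + D)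
    (hS : μ ≤ ∑ x ∈ S, p x) (hT : μ ≤ ∑ x ∈ T, p x) :
    μ / 2 * D ^ 2 ≤ variance p f := by
  classical
  rw [variance_eq_sum_mul_sub_sq hp1]
  set m := ∑ y, p y * f y
  calc μ / 2 * D ^ 2 ≤ μ * (c - m) ^ 2 + μ * (c + D - m) ^ 2 := by
        nlinarith [mul_nonneg hμ (sq_nonneg (2 * (c - m) + D))]
    _ ≤ (∑ x ∈ S, p x) * (c - m) ^ 2 + (∑ x ∈ T, p x) * (c + D - m) ^ 2 := by gcongr
    _ = ∑ x ∈ S ∪ T, p x * (f x - m) ^ 2 := by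
        rw [Finset.sum_union hST, Finset.sum_mul, Finset.sum_mul]
        congr 1
        · exact Finset.sum_congr rfl fun x hx => by rw [hfS x hx]
        · exact Finset.sum_congr rfl fun x hx => by rw [hfT x hx]
    _ ≤ ∑ x, p x * (f x - m) ^ 2 :=
        Finset.sum_le_sum_of_subset_of_nonneg (Finset.subset_univ _) fun x _ _ =>
          mul_nonneg (hp x) (sq_nonneg _)

end Variance

section Poincare

variable {ι : Type} [Fintype ι] [DecidableEq ι]

lemma star_mul_diagOp_mul_self_apply (A : Op ι) (f : (ι → ZMod 2) → ℝ) (y : ι → ZMod 2) :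
    (star A * diagOp f * A) y y = ((∑ x, ‖A x y‖ ^ 2 * f x : ℝ) : ℂ) := by
  rw [Matrix.mul_apply, Complex.ofReal_sum]
  refine Finset.sum_congr rfl fun x _ => ?_
  rw [mul_diagOp_apply, Matrix.star_apply, RCLike.star_def, mul_right_comm, Complex.conj_mul',
    Complex.ofReal_mul, Complex.ofReal_pow]

lemma star_mul_self_apply_self (A : Op ι) (y : ι → ZMod 2) :
    (star A * A) y y = ((∑ x, ‖A x y‖ ^ 2 : ℝ) : ℂ) := by
  simpa using star_mul_diagOp_mul_self_apply A 1 y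

lemma sum_norm_sq_unitary {U : Op ι} (hU : U ∈ Matrix.unitaryGroup (ι → ZMod 2) ℂ)
    (y : ι → ZMod 2) : ∑ x, ‖U x y‖ ^ 2 = 1 := by
  have h := star_mul_self_apply_self U y
  rw [Matrix.mem_unitaryGroup_iff'.1 hU, Matrix.one_apply_eq] at h
  exact_mod_cast h.symm

lemma sum_norm_sq_star_mul_diagOp_mul {U : Op ι} (hU : U ∈ Matrix.unitaryGroup (ι → ZMod 2) ℂ)
    (f : (ι → ZMod 2) → ℝ) (y : ι → ZMod 2) :
    ∑ z, ‖(star U * diagOp f * U) z y‖ ^ 2 = ∑ x, ‖U x y‖ ^ 2 * f x ^ 2 := by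
  have hsq : star (star U * diagOp f * U) * (star U * diagOp f * U) = star U * diagOp (f ^ 2) * U :=
    calc star (star U * diagOp f * U) * (star U * diagOp f * U)
        = star U * star (diagOp f) * (U * star U) * diagOp f * U := by
          simp only [star_mul, star_star, mul_assoc]
      _ = star U * diagOp (f ^ 2) * U := by
          rw [Matrix.mem_unitaryGroup_iff.1 hU, mul_one, Matrix.star_eq_conjTranspose (diagOp f),
            (isHermitian_diagOp f).eq, mul_assoc (star U), ← map_mul, sq]
  apply Complex.ofReal_injective
  rw [← star_mul_self_apply_self, hsq, star_mul_diagOp_mul_self_apply]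
  rfl

lemma sum_sub_apply_zero_le {q : (ι → ZMod 2) → ℝ} (hq : ∀ y, 0 ≤ q y) :
    ∑ y, q y - q 0 ≤ ∑ i, ∑ y with y i = 1, q y := by
  have hterm (y : ι → ZMod 2) (i : ι) : 0 ≤ if y i = 1 then q y else 0 := by
    split_ifs
    exacts [hq y, le_rfl]
  calc ∑ y, q y - q 0 = ∑ y ∈ Finset.univ.erase 0, q y := by
        rw [← Finset.sum_erase_add _ _ (Finset.mem_univ 0), add_sub_cancel_right]
    _ ≤ ∑ y ∈ Finset.univ.erase 0, ∑ i, if y i = 1 then q y else 0 := by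
        refine Finset.sum_le_sum fun y hy => ?_
        obtain ⟨i, hi⟩ := Function.ne_iff.1 (Finset.ne_of_mem_erase hy)
        refine le_trans ?_ (Finset.single_le_sum (fun j _ => hterm y j) (Finset.mem_univ i))
        rw [if_pos (bit_eq_one_of_ne_zero hi)]
    _ ≤ ∑ y, ∑ i, if y i = 1 then q y else 0 :=
        Finset.sum_le_sum_of_subset_of_nonneg (Finset.erase_subset _ _) fun y _ _ =>
          Finset.sum_nonneg fun i _ => hterm y i
    _ = ∑ i, ∑ y with y i = 1, q y := by
        rw [Finset.sum_comm]
        simp only [Finset.sum_filter]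

lemma star_mul_diagOp_mul_apply_zero_eq_zero {U : Op ι}
    (hU : U ∈ Matrix.unitaryGroup (ι → ZMod 2) ℂ) {i : ι} {S : Set ι}
    (hS : U * pauliZ (Pi.single i 1) * star U ∈ supportedOn S)
    {g : (ι → ZMod 2) → ℝ} (hg : ∀ x y, (∀ j ∉ S, x j = y j) → g x = g y)
    {y : ι → ZMod 2} (hy : y i = 1) :
    (star U * diagOp g * U) y 0 = 0 := by
  have hUU : star U * U = 1 := Matrix.mem_unitaryGroup_iff'.1 hU
  set Z : Op ι := pauliZ (Pi.single i 1) with hZ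
  set B := star U * diagOp g * U with hB
  have hcomm : B * Z = Z * B :=
    calc B * Z = star U * (diagOp g * (U * Z * star U)) * U := by
          simp only [hB, mul_assoc, hUU, mul_one]
      _ = star U * U * Z * B := by
          rw [(commute_diagOp_of_mem_supportedOn hS hg).eq]
          simp only [hB, mul_assoc]
      _ = Z * B := by rw [hUU, one_mul]
  have h := congrFun₂ hcomm y 0
  rw [hZ, pauliZ_eq_diagOp, mul_diagOp_apply, diagOp_mul_apply, dotProduct_zero,
    AddChar.map_zero_eq_one, single_dotProduct, one_mul, hy, sgn_one] at h
  push_cast at h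
  linear_combination (1 / 2 : ℂ) * h

lemma variance_eq_sum_norm_sq_sub {U : Op ι} (hU : U ∈ Matrix.unitaryGroup (ι → ZMod 2) ℂ)
    (f : (ι → ZMod 2) → ℝ) :
    variance (fun x => ‖U x 0‖ ^ 2) f =
      ∑ y, ‖(star U * diagOp f * U) y 0‖ ^ 2 - ‖(star U * diagOp f * U) 0 0‖ ^ 2 := by
  rw [sum_norm_sq_star_mul_diagOp_mul hU, star_mul_diagOp_mul_self_apply, Complex.norm_real,
    Real.norm_eq_abs, sq_abs, variance]

lemma variance_le_sum_sq {U : Op ι} (hU : U ∈ Matrix.unitaryGroup (ι → ZMod 2) ℂ)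
    {S : ι → Set ι} (hS : ∀ i, U * pauliZ (Pi.single i 1) * star U ∈ supportedOn (S i))
    {f : (ι → ZMod 2) → ℝ} {g : ι → (ι → ZMod 2) → ℝ} {b : ι → ℝ}
    (hg : ∀ i x y, (∀ j ∉ S i, x j = y j) → g i x = g i y) (hfg : ∀ i x, |f x - g i x| ≤ b i) :
    variance (fun x => ‖U x 0‖ ^ 2) f ≤ ∑ i, b i ^ 2 := by
  rw [variance_eq_sum_norm_sq_sub hU]
  refine (sum_sub_apply_zero_le fun y => sq_nonneg _).trans (Finset.sum_le_sum fun i _ => ?_)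
  have hsub (y : ι → ZMod 2) (hy : y i = 1) :
      (star U * diagOp f * U) y 0 = (star U * diagOp (f - g i) * U) y 0 := by
    rw [map_sub, mul_sub, sub_mul, Matrix.sub_apply,
      star_mul_diagOp_mul_apply_zero_eq_zero hU (hS i) (hg i) hy, sub_zero]
  calc ∑ y with y i = 1, ‖(star U * diagOp f * U) y 0‖ ^ 2
      = ∑ y with y i = 1, ‖(star U * diagOp (f - g i) * U) y 0‖ ^ 2 :=
        Finset.sum_congr rfl fun y hy => by rw [hsub y (Finset.mem_filter.1 hy).2]
    _ ≤ ∑ y, ‖(star U * diagOp (f - g i) * U) y 0‖ ^ 2 :=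
        Finset.sum_le_sum_of_subset_of_nonneg (Finset.filter_subset _ _) fun _ _ _ => sq_nonneg _
    _ = ∑ x, ‖U x 0‖ ^ 2 * |f x - g i x| ^ 2 := by
        simp only [sum_norm_sq_star_mul_diagOp_mul hU, sq_abs, Pi.sub_apply]
    _ ≤ ∑ x, ‖U x 0‖ ^ 2 * b i ^ 2 := by
        gcongr with x
        exact hfg i x
    _ = b i ^ 2 := by rw [← Finset.sum_mul, sum_norm_sq_unitary hU, one_mul]

end Poincare

/-! ### Measurement distributions -/

section States

variable {ι κ : Type} [Fintype ι] [DecidableEq ι] [Fintype κ] [DecidableEq κ]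

/-- The distribution of the outcome when `ρ` is measured in the computational basis. -/
def prob (ρ : Op ι) (x : ι → ZMod 2) : ℝ := (ρ x x).re

omit [Fintype ι] [DecidableEq ι] in
lemma prob_nonneg {ρ : Op ι} (hρ : ρ.PosSemidef) (x : ι → ZMod 2) : 0 ≤ prob ρ x :=
  (Complex.le_def.1 (hρ.diag_nonneg (i := x))).1

lemma IsState.sum_prob {ρ : Op ι} (hρ : IsState ρ) : ∑ x, prob ρ x = 1 := by
  simpa only [Matrix.trace, Matrix.diag_apply, prob, Complex.re_sum, Complex.one_re] using
    congrArg Complex.re hρ.2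

lemma trace_mul_diagOp_re (ρ : Op ι) (f : (ι → ZMod 2) → ℝ) :
    (Matrix.trace (ρ * diagOp f)).re = ∑ x, prob ρ x * f x := by
  simp only [Matrix.trace, Matrix.diag_apply, mul_diagOp_apply, Complex.re_sum,
    Complex.re_mul_ofReal, prob]

lemma trace_mul_hadamardConj (ρ A : Op ι) :
    Matrix.trace (ρ * hadamardConj A) = Matrix.trace (hadamardConj ρ * A) := by
  rw [hadamardConj_apply, hadamardConj_apply, ← mul_assoc, Matrix.trace_mul_comm]
  simp only [mul_assoc]

lemma posSemidef_hadamardConj {A : Op ι} (hA : A.PosSemidef) : (hadamardConj A).PosSemidef := by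
  simpa only [hadamardConj_apply, hadamard_conjTranspose] using
    hA.conjTranspose_mul_mul_same (hadamard : Op ι)

lemma IsState.hadamardConj {ρ : Op ι} (hρ : IsState ρ) : IsState (hadamardConj ρ) := by
  refine ⟨posSemidef_hadamardConj hρ.1, ?_⟩
  rw [← mul_one (NLTS.hadamardConj ρ), ← trace_mul_hadamardConj, map_one, mul_one, hρ.2]

/-- The amplitudes of a vector on two registers, with the second register as column index. -/
def amplitudes (ψ : (ι ⊕ κ → ZMod 2) → ℂ) : Matrix (ι → ZMod 2) (κ → ZMod 2) ℂ :=
  Matrix.of fun x z => ψ (Sum.elim x z)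

/-- The operator left of the pure state `ψ` when the second register is traced out. -/
def reducedState (ψ : (ι ⊕ κ → ZMod 2) → ℂ) : Op ι := amplitudes ψ * (amplitudes ψ)ᴴ

omit [Fintype ι] [DecidableEq ι] in
lemma posSemidef_reducedState [Finite ι] (ψ : (ι ⊕ κ → ZMod 2) → ℂ) :
    (reducedState ψ).PosSemidef :=
  Matrix.posSemidef_self_mul_conjTranspose _

lemma outputState_eq_reducedState {n a : ℕ} (C : Circuit (Fin n ⊕ Fin a)) :
    C.outputState = reducedState C.outputVec := rfl

omit [Fintype ι] [DecidableEq ι] in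
lemma prob_reducedState (ψ : (ι ⊕ κ → ZMod 2) → ℂ) (x : ι → ZMod 2) :
    prob (reducedState ψ) x = ∑ z : κ → ZMod 2, ‖ψ (Sum.elim x z)‖ ^ 2 := by
  simp only [prob, reducedState, Matrix.mul_apply, Matrix.conjTranspose_apply, RCLike.star_def,
    Complex.mul_conj', amplitudes, Matrix.of_apply, Complex.re_sum]
  norm_cast

lemma sum_prob_reducedState_mul (ψ : (ι ⊕ κ → ZMod 2) → ℂ) (f : (ι → ZMod 2) → ℝ) :
    ∑ x, prob (reducedState ψ) x * f x = ∑ x, ‖ψ x‖ ^ 2 * f (x ∘ Sum.inl) := by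
  rw [← (Equiv.sumArrowEquivProdArrow ι κ (ZMod 2)).symm.sum_comp, Fintype.sum_prod_type]
  simp only [prob_reducedState, Finset.sum_mul]
  rfl

omit [DecidableEq ι] [DecidableEq κ] in
lemma hadamard_sumElim (x y : ι → ZMod 2) (z w : κ → ZMod 2) :
    hadamard (Sum.elim x z) (Sum.elim y w) = hadamard x y * hadamard z w := by
  simp only [hadamard_apply, Fintype.prod_sum_type, Sum.elim_inl, Sum.elim_inr]

lemma amplitudes_hadamard_mulVec (ψ : (ι ⊕ κ → ZMod 2) → ℂ) :
    amplitudes (hadamard *ᵥ ψ) = (hadamard : Op ι) * amplitudes ψ * (hadamard : Op κ) := by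
  ext x z
  simp only [amplitudes, Matrix.of_apply, Matrix.mulVec, dotProduct, Matrix.mul_apply]
  rw [← (Equiv.sumArrowEquivProdArrow ι κ (ZMod 2)).symm.sum_comp, Fintype.sum_prod_type_right]
  refine Finset.sum_congr rfl fun w _ => ?_
  rw [Finset.sum_mul]
  refine Finset.sum_congr rfl fun y _ => ?_
  rw [show (Equiv.sumArrowEquivProdArrow ι κ (ZMod 2)).symm (y, w) = Sum.elim y w from rfl,
    hadamard_sumElim, hadamard_symm w z]
  ring

lemma hadamardConj_reducedState (ψ : (ι ⊕ κ → ZMod 2) → ℂ) :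
    hadamardConj (reducedState ψ) = reducedState (hadamard *ᵥ ψ) := by
  calc hadamardConj (reducedState ψ)
      = (hadamard : Op ι) * amplitudes ψ * ((hadamard : Op κ) * hadamard) * (amplitudes ψ)ᴴ *
          hadamard := by
        rw [hadamard_mul_self, Matrix.mul_one, hadamardConj_apply, reducedState]
        simp only [Matrix.mul_assoc]
    _ = reducedState (hadamard *ᵥ ψ) := by
        rw [reducedState, amplitudes_hadamard_mulVec]
        simp only [Matrix.conjTranspose_mul, hadamard_conjTranspose, Matrix.mul_assoc]

end States

/-! ### Shallow circuits do not produce spread distributions -/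

section Spread

variable {ι κ : Type} [Fintype ι]

/-- A distribution on bit strings is spread if it gives probability at least `μ` to each of two
sets at Hamming distance at least `D`. -/
def IsSpread (p : (ι → ZMod 2) → ℝ) (μ D : ℝ) : Prop :=
  ∃ S T : Finset (ι → ZMod 2), (∀ x ∈ S, ∀ y ∈ T, D ≤ hammingDist x y) ∧
    μ ≤ ∑ x ∈ S, p x ∧ μ ≤ ∑ x ∈ T, p x

lemma exists_lipschitz_separator {S : Set (ι → ZMod 2)} (hS : S.Nonempty) {D : ℝ} (hD : 0 ≤ D) :
    ∃ f : (ι → ZMod 2) → ℝ, (∀ x ∈ S, f x = 0) ∧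
      (∀ y, (∀ x ∈ S, D ≤ hammingDist x y) → f y = D) ∧
      ∀ x y, |f x - f y| ≤ hammingDist x y := by
  let S' : Set (Hamming fun _ : ι => ZMod 2) := Hamming.ofHamming ⁻¹' S
  have hS' : S'.Nonempty := hS
  refine ⟨fun x => min (Metric.infDist (Hamming.toHamming x) S') D, fun x hx => ?_,
    fun y hy => ?_, fun x y => ?_⟩
  · have hzero : Metric.infDist (Hamming.toHamming x) S' = 0 := Metric.infDist_zero_of_mem hx
    simp only [hzero, min_eq_left hD]
  · refine min_eq_right ((Metric.le_infDist hS').2 fun z hz => ?_)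
    rw [dist_comm, Hamming.dist_eq_hammingDist]
    exact hy _ hz
  · have hlip := (Metric.lipschitz_infDist_pt S').dist_le_mul (Hamming.toHamming x)
      (Hamming.toHamming y)
    rw [NNReal.coe_one, one_mul, Hamming.dist_eq_hammingDist, Real.dist_eq] at hlip
    refine (abs_min_sub_min_le_max _ _ _ _).trans ?_
    rwa [sub_self, abs_zero, max_eq_left (abs_nonneg _)]

variable [DecidableEq ι]

lemma IsSpread.exists_lipschitz_le_variance {p : (ι → ZMod 2) → ℝ} {μ D : ℝ}
    (h : IsSpread p μ D) (hp : ∀ x, 0 ≤ p x) (hp1 : ∑ x, p x = 1) (hμ : 0 < μ) (hD : 0 < D) :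
    ∃ f : (ι → ZMod 2) → ℝ, (∀ x y, |f x - f y| ≤ hammingDist x y) ∧
      μ / 2 * D ^ 2 ≤ variance p f := by
  obtain ⟨S, T, hdist, hS, hT⟩ := h
  have hSne : (S : Set (ι → ZMod 2)).Nonempty :=
    Finset.nonempty_of_sum_ne_zero (hμ.trans_le hS).ne'
  obtain ⟨f, hfS, hfT, hf⟩ := exists_lipschitz_separator hSne hD.le
  have hST : Disjoint S T := Finset.disjoint_left.2 fun x hxS hxT => by
    have hle := hdist x hxS x hxT
    rw [hammingDist_self, Nat.cast_zero] at hle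
    exact hD.not_ge hle
  refine ⟨f, hf, le_variance_of_two_values hp hp1 hST hμ.le (fun x hx => hfS x hx)
    (fun y hy => ?_) hS hT⟩
  rw [zero_add]
  exact hfT y fun x hx => hdist x hx y hy

variable [Fintype κ] [DecidableEq κ]

lemma variance_prob_reducedState_le {U : Op (ι ⊕ κ)}
    (hU : U ∈ Matrix.unitaryGroup (ι ⊕ κ → ZMod 2) ℂ) {S : ι ⊕ κ → Set (ι ⊕ κ)}
    (hS : ∀ i, U * pauliZ (Pi.single i 1) * star U ∈ supportedOn (S i))
    {f : (ι → ZMod 2) → ℝ} (hf : ∀ x y, |f x - f y| ≤ hammingDist x y) :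
    variance (prob (reducedState (U *ᵥ Pi.single 0 1))) f ≤
      ∑ i, ({j | Sum.inl j ∈ S i}.ncard : ℝ) ^ 2 := by
  classical
  have hvar : variance (prob (reducedState (U *ᵥ Pi.single 0 1))) f =
      variance (fun x => ‖U x 0‖ ^ 2) fun x => f (x ∘ Sum.inl) := by
    rw [variance, variance, sum_prob_reducedState_mul _ f,
      sum_prob_reducedState_mul _ fun x => f x ^ 2]
    simp only [Matrix.mulVec_single_one, Matrix.col_apply]
  rw [hvar]
  refine variance_le_sum_sq hU hS
    (g := fun i x => f fun j => if Sum.inl j ∈ S i then 0 else x (Sum.inl j))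
    (fun i x y hxy => ?_) fun i x => (hf _ _).trans ?_
  · refine congrArg f (funext fun j => ?_)
    split_ifs with hj
    exacts [rfl, hxy _ hj]
  · rw [Nat.cast_le, hammingDist, ← Set.ncard_coe_finset]
    refine Set.ncard_le_ncard fun j hj => ?_
    by_contra hjS
    simp [show Sum.inl j ∉ S i from hjS] at hj

lemma Circuit.sq_mul_le_of_isSpread (C : Circuit (ι ⊕ κ)) {U : Op (ι ⊕ κ)}
    (hU : U ∈ Matrix.unitaryGroup (ι ⊕ κ → ZMod 2) ℂ)
    (hcone : ∀ i, U * pauliZ (Pi.single i 1) * star U ∈ supportedOn {j | C.Reach i j})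
    {μ D : ℝ} (hμ : 0 < μ) (hD : 0 < D)
    (h : IsSpread (prob (reducedState (U *ᵥ Pi.single 0 1))) μ D) :
    μ / 2 * D ^ 2 ≤ Fintype.card ι * 4 ^ C.depth := by
  have hsum : ∑ x, prob (reducedState (U *ᵥ Pi.single 0 1)) x = 1 := by
    simpa [sum_norm_sq_unitary hU] using
      sum_prob_reducedState_mul (U *ᵥ Pi.single 0 1) fun _ : ι → ZMod 2 => 1
  obtain ⟨f, hf, hvar⟩ := h.exists_lipschitz_le_variance
    (prob_nonneg (posSemidef_reducedState _)) hsum hμ hD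
  refine hvar.trans ((variance_prob_reducedState_le hU hcone hf).trans ?_)
  have hforward (i : ι ⊕ κ) : {j | C.Reach i (Sum.inl j)}.ncard ≤ 2 ^ C.depth :=
    (Set.ncard_le_ncard_of_injOn Sum.inl (fun _ hj => hj) Sum.inl_injective.injOn).trans
      (C.ncard_forwardCone_le i)
  have hcones := sum_ncard_sq_le hforward fun j : ι => C.ncard_backwardCone_le (Sum.inl j)
  rw [← pow_mul, mul_comm C.depth, pow_mul] at hcones
  exact_mod_cast hcones

variable {n a : ℕ}

lemma Circuit.conj_pauliZ_single_mem_supportedOn (C : Circuit ι) (i : ι) :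
    C.toOp * pauliZ (Pi.single i 1) * star C.toOp ∈ supportedOn {j | C.Reach i j} := by
  simpa using C.conj_mem_supportedOn
    (pauliZ_mem_supportedOn (S := {i}) fun j hj => Pi.single_eq_of_ne hj _)

lemma Circuit.sq_mul_le_of_isSpread_prob (C : Circuit (Fin n ⊕ Fin a)) {μ D : ℝ} (hμ : 0 < μ)
    (hD : 0 < D) (h : IsSpread (prob C.outputState) μ D) :
    μ / 2 * D ^ 2 ≤ n * 4 ^ C.depth := by
  simpa using C.sq_mul_le_of_isSpread C.toOp_mem_unitaryGroup
    C.conj_pauliZ_single_mem_supportedOn hμ hD h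

lemma Circuit.sq_mul_le_of_isSpread_prob_hadamardConj (C : Circuit (Fin n ⊕ Fin a)) {μ D : ℝ}
    (hμ : 0 < μ) (hD : 0 < D) (h : IsSpread (prob (hadamardConj C.outputState)) μ D) :
    μ / 2 * D ^ 2 ≤ n * 4 ^ C.depth := by
  rw [outputState_eq_reducedState, hadamardConj_reducedState, Circuit.outputVec,
    Matrix.mulVec_mulVec] at h
  have hcone (i : Fin n ⊕ Fin a) : hadamard * C.toOp * pauliZ (Pi.single i 1) *
      star (hadamard * C.toOp) ∈ supportedOn {j | C.Reach i j} := by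
    have hmem := hadamardConj_mem_supportedOn (C.conj_pauliZ_single_mem_supportedOn i)
    rw [hadamardConj_apply] at hmem
    rw [star_mul, Matrix.star_eq_conjTranspose hadamard, hadamard_conjTranspose]
    simpa only [mul_assoc] using hmem
  simpa using C.sq_mul_le_of_isSpread
    (mul_mem hadamard_mem_unitaryGroup C.toOp_mem_unitaryGroup) hcone hμ hD h

end Spread

/-! ### The code Hamiltonian -/

section Hamiltonian

variable {n mX mZ : ℕ}

section Violation

variable {m : ℕ}

/-- The fraction of the parity checks of `H` violated by `y`; it is `0` if there are no checks. -/
def violation (H : Matrix (Fin m) (Fin n) (ZMod 2)) (y : Fin n → ZMod 2) : ℝ :=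
  (hammingNorm (H *ᵥ y) : ℝ) / m

lemma violation_nonneg (H : Matrix (Fin m) (Fin n) (ZMod 2)) (y : Fin n → ZMod 2) :
    0 ≤ violation H y := by
  unfold violation
  positivity

lemma violation_le_one (H : Matrix (Fin m) (Fin n) (ZMod 2)) (y : Fin n → ZMod 2) :
    violation H y ≤ 1 := by
  refine div_le_one_of_le₀ ?_ (Nat.cast_nonneg _)
  exact_mod_cast (hammingNorm_le_card_fintype (x := H *ᵥ y)).trans_eq (Fintype.card_fin m)

lemma violation_eq_sum (H : Matrix (Fin m) (Fin n) (ZMod 2)) (y : Fin n → ZMod 2) :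
    violation H y = (1 / m : ℝ) * ∑ i, (1 - sgn (H i ⬝ᵥ y)) / 2 := by
  simp only [one_sub_sgn_div_two, Finset.sum_boole, violation, hammingNorm]
  rw [div_eq_inv_mul, one_div]
  rfl

lemma average_one_sub_pauliZ (H : Matrix (Fin m) (Fin n) (ZMod 2)) :
    (1 / (m : ℂ)) • ∑ i, (1 / 2 : ℂ) • (1 - pauliZ (H i)) = diagOp (violation H) := by
  ext x y
  simp only [Matrix.smul_apply, Matrix.sum_apply, Matrix.sub_apply, pauliZ_eq_diagOp,
    diagOp_eq_diagonal, smul_eq_mul]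
  by_cases hxy : x = y
  · subst hxy
    simp only [Matrix.diagonal_apply_eq, Matrix.one_apply_eq, violation_eq_sum]
    push_cast
    simp only [sub_div, one_div, inv_mul_eq_div, mul_sub]
  · simp [hxy]

lemma average_one_sub_pauliX (H : Matrix (Fin m) (Fin n) (ZMod 2)) :
    (1 / (m : ℂ)) • ∑ i, (1 / 2 : ℂ) • (1 - pauliX (H i)) =
      hadamardConj (diagOp (violation H)) := by
  simp only [← average_one_sub_pauliZ, map_smul, map_sum, map_sub, map_one, hadamardConj_pauliZ]

lemma posSemidef_diagOp {f : (Fin n → ZMod 2) → ℝ} (hf : ∀ x, 0 ≤ f x) :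
    (diagOp f).PosSemidef :=
  Matrix.PosSemidef.diagonal fun x => by simpa using hf x

lemma posSemidef_one_sub_diagOp_violation (H : Matrix (Fin m) (Fin n) (ZMod 2)) :
    (1 - diagOp (violation H)).PosSemidef := by
  rw [← map_one diagOp, ← map_sub]
  exact posSemidef_diagOp fun y => sub_nonneg.2 (violation_le_one H y)

end Violation

lemma CSSCode.hamiltonian_eq (Q : CSSCode n mX mZ) :
    Q.hamiltonian =
      (1 / 2 : ℂ) • (hadamardConj (diagOp (violation Q.HX)) + diagOp (violation Q.HZ)) := by
  rw [CSSCode.hamiltonian, average_one_sub_pauliX, average_one_sub_pauliZ]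

lemma CSSCode.trace_mul_hamiltonian_re (Q : CSSCode n mX mZ) (ρ : Op (Fin n)) :
    (Matrix.trace (ρ * Q.hamiltonian)).re =
      (∑ y, prob (hadamardConj ρ) y * violation Q.HX y + ∑ y, prob ρ y * violation Q.HZ y) / 2 := by
  rw [Q.hamiltonian_eq, Matrix.mul_smul, Matrix.trace_smul, Matrix.mul_add, Matrix.trace_add,
    trace_mul_hadamardConj, ← trace_mul_diagOp_re, ← trace_mul_diagOp_re, smul_eq_mul,
    Complex.mul_re, Complex.add_re]
  norm_num
  ring

lemma CSSCode.posSemidef_hamiltonian (Q : CSSCode n mX mZ) : Q.hamiltonian.PosSemidef := by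
  rw [Q.hamiltonian_eq]
  exact ((posSemidef_hadamardConj (posSemidef_diagOp (violation_nonneg _))).add
    (posSemidef_diagOp (violation_nonneg _))).smul (by simp)

lemma CSSCode.posSemidef_one_sub_hamiltonian (Q : CSSCode n mX mZ) :
    (1 - Q.hamiltonian).PosSemidef := by
  have hsplit : 1 - Q.hamiltonian = (1 / 2 : ℂ) •
      (hadamardConj (1 - diagOp (violation Q.HX)) + (1 - diagOp (violation Q.HZ))) := by
    rw [Q.hamiltonian_eq, map_sub, map_one]
    module
  rw [hsplit]
  exact ((posSemidef_hadamardConj (posSemidef_one_sub_diagOp_violation _)).add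
    (posSemidef_one_sub_diagOp_violation _)).smul (by simp)

section Locality

variable {ι : Type} [Fintype ι] [DecidableEq ι] {ℓ : ℕ}

/-- A Hamiltonian acting nontrivially on at most `ℓ` qubits. -/
def IsLocalTerm (ℓ : ℕ) (A : Op ι) : Prop :=
  ∃ (S : Finset ι) (u : Op S), S.card ≤ ℓ ∧ u.IsHermitian ∧ localOp S u = A

lemma isLocalHamiltonian_sum {κ : Type*} [Fintype κ] {A : κ → Op ι}
    (hA : ∀ k, IsLocalTerm ℓ (A k)) : IsLocalHamiltonian ℓ (∑ k, A k) := by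
  choose S u hcard hherm hloc using hA
  let e := Fintype.equivFin κ
  refine ⟨Fintype.card κ, fun i => S (e.symm i), fun i => u (e.symm i), fun i => hcard _,
    fun i => hherm _, ?_⟩
  simp only [hloc, e.symm.sum_comp A]

lemma IsLocalTerm.smul_one_sub {A : Op ι} (hA : IsLocalTerm ℓ A) {c : ℂ} (hc : IsSelfAdjoint c) :
    IsLocalTerm ℓ (c • (1 - A)) := by
  obtain ⟨S, u, hcard, hherm, rfl⟩ := hA
  refine ⟨S, c • (1 - u), hcard, (Matrix.isHermitian_one.sub hherm).smul hc, ?_⟩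
  simp only [← localOpHom_apply, map_smul, map_sub, map_one]

omit [DecidableEq ι] in
lemma isHermitian_pauliZ (a : ι → ZMod 2) : (pauliZ a).IsHermitian := by
  classical
  rw [pauliZ_eq_diagOp]
  exact isHermitian_diagOp _

omit [DecidableEq ι] in
lemma isHermitian_pauliX (a : ι → ZMod 2) : (pauliX a).IsHermitian := by
  classical
  rw [← hadamardConj_pauliZ]
  exact IsSelfAdjoint.map (isHermitian_pauliZ a) hadamardConj

lemma isLocalTerm_pauliZ {a : ι → ZMod 2} (ha : hammingNorm a ≤ ℓ) : IsLocalTerm ℓ (pauliZ a) :=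
  ⟨bitSupport a, _, ha, isHermitian_pauliZ _, localOp_pauliZ a⟩

lemma isLocalTerm_pauliX {a : ι → ZMod 2} (ha : hammingNorm a ≤ ℓ) : IsLocalTerm ℓ (pauliX a) :=
  ⟨bitSupport a, _, ha, isHermitian_pauliX _, localOp_pauliX a⟩

lemma CSSCode.isLocalHamiltonian_hamiltonian (Q : CSSCode n mX mZ)
    (hX : ∀ i, hammingNorm (Q.HX i) ≤ ℓ) (hZ : ∀ i, hammingNorm (Q.HZ i) ≤ ℓ) :
    IsLocalHamiltonian ℓ Q.hamiltonian := by
  have hself (m : ℕ) : IsSelfAdjoint (1 / 2 * (1 / (m : ℂ)) * (1 / 2)) := by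
    simp [isSelfAdjoint_iff]
  have hsum : Q.hamiltonian = ∑ k : Fin mX ⊕ Fin mZ, Sum.elim
      (fun i => (1 / 2 * (1 / (mX : ℂ)) * (1 / 2)) • (1 - pauliX (Q.HX i)))
      (fun i => (1 / 2 * (1 / (mZ : ℂ)) * (1 / 2)) • (1 - pauliZ (Q.HZ i))) k := by
    simp only [Fintype.sum_sum_type, Sum.elim_inl, Sum.elim_inr, CSSCode.hamiltonian, smul_add,
      Finset.smul_sum, smul_smul, mul_assoc]
  rw [hsum]
  refine isLocalHamiltonian_sum ?_
  rintro (i | i)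
  · exact (isLocalTerm_pauliX (hX i)).smul_one_sub (hself mX)
  · exact (isLocalTerm_pauliZ (hZ i)).smul_one_sub (hself mZ)

end Locality

end Hamiltonian

/-! ### An uncertainty relation -/

section Uncertainty

variable {ι : Type} [Fintype ι] [DecidableEq ι]

lemma sq_expectation_add_sq_le_one {ρ A B : Op ι} (hρ : IsState ρ) (hA : A.IsHermitian)
    (hB : B.IsHermitian) (hA2 : A * A = 1) (hB2 : B * B = 1) (hAB : A * B = -(B * A)) :
    (Matrix.trace (ρ * A)).re ^ 2 + (Matrix.trace (ρ * B)).re ^ 2 ≤ 1 := by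
  set α : ℝ := (Matrix.trace (ρ * A)).re
  set β : ℝ := (Matrix.trace (ρ * B)).re
  -- `α • A + β • B` has square `α ^ 2 + β ^ 2`, which is also its expectation.
  set M : Op ι := (α : ℂ) • A + (β : ℂ) • B - 1 with hM
  have hherm : Mᴴ = M := by
    simp [hM, Matrix.conjTranspose_smul, hA.eq, hB.eq]
  have hsq : M * M = (α ^ 2 + β ^ 2 + 1 : ℂ) • 1 - (2 : ℂ) • ((α : ℂ) • A + (β : ℂ) • B) := by
    simp only [hM, Matrix.sub_mul, Matrix.mul_sub, Matrix.add_mul, Matrix.mul_add, hA2, hB2, hAB,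
      Matrix.smul_mul, Matrix.mul_smul, Matrix.mul_one, Matrix.one_mul]
    module
  have hpos : 0 ≤ (Matrix.trace (ρ * (M * M))).re := by
    have hnonneg := (hρ.1.conjTranspose_mul_mul_same M).trace_nonneg
    rw [hherm, Matrix.mul_assoc, Matrix.trace_mul_comm, Matrix.mul_assoc] at hnonneg
    exact (Complex.le_def.1 hnonneg).1
  have hexp : (Matrix.trace (ρ * (M * M))).re = 1 - (α ^ 2 + β ^ 2) := by
    rw [hsq]
    simp only [Matrix.mul_sub, Matrix.mul_add, Matrix.mul_smul, Matrix.mul_one, Matrix.trace_sub,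
      Matrix.trace_add, Matrix.trace_smul, hρ.2, smul_eq_mul, ← Complex.ofReal_pow]
    simp only [Complex.sub_re, Complex.add_re, Complex.mul_re, Complex.add_im, Complex.mul_im,
      Complex.ofReal_re, Complex.ofReal_im, Complex.one_re, Complex.one_im, Complex.re_ofNat,
      Complex.im_ofNat]
    ring
  linarith

lemma hadamardConj_diagOp_apply_eq_zero {s : (ι → ZMod 2) → ℝ} {a w : ι → ZMod 2}
    (hs : ∀ z, s (z + w) = sgn (a ⬝ᵥ w) * s z) {x y : ι → ZMod 2}
    (hw : (x + y + a) ⬝ᵥ w ≠ 0) : hadamardConj (diagOp s) x y = 0 := by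
  have htwist : diagOp s * pauliX w = (sgn (a ⬝ᵥ w) : ℂ) • (pauliX w * diagOp s) := by
    ext u v
    rw [diagOp_mul_apply, Matrix.smul_apply, mul_diagOp_apply, pauliX, Matrix.of_apply]
    split_ifs with huv
    · rw [huv, hs]
      simp
    · simp
  have hconj := congrFun₂ (congrArg hadamardConj htwist) x y
  rw [map_mul, map_smul, map_mul, ← hadamardConj_pauliZ, hadamardConj_hadamardConj,
    pauliZ_eq_diagOp, mul_diagOp_apply, Matrix.smul_apply, diagOp_mul_apply, smul_eq_mul] at hconj
  have hneg : sgn (a ⬝ᵥ w) * sgn (w ⬝ᵥ x) = -sgn (w ⬝ᵥ y) := by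
    have hprod := congrArg sgn (bit_eq_one_of_ne_zero hw)
    rw [sgn_one, add_dotProduct, add_dotProduct, AddChar.map_add_eq_mul, AddChar.map_add_eq_mul,
      dotProduct_comm x, dotProduct_comm y] at hprod
    linear_combination sgn (w ⬝ᵥ y) * hprod -
      sgn (a ⬝ᵥ w) * sgn (w ⬝ᵥ x) * sgn_mul_self (w ⬝ᵥ y)
  have hne : (sgn (w ⬝ᵥ y) : ℂ) ≠ 0 := by
    exact_mod_cast left_ne_zero_of_mul_eq_one (sgn_mul_self (w ⬝ᵥ y))
  rw [← mul_assoc, ← Complex.ofReal_mul, hneg] at hconj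
  push_cast at hconj
  refine (mul_eq_zero.1 ?_).resolve_right hne
  linear_combination hconj / 2

lemma hadamardConj_diagOp_anticommute {n : ℕ} {C : Submodule (ZMod 2) (Fin n → ZMod 2)}
    {s s' : (Fin n → ZMod 2) → ℝ} {a : Fin n → ZMod 2}
    (hs : ∀ z, ∀ w ∈ C, s (z + w) = sgn (a ⬝ᵥ w) * s z)
    (hs' : ∀ y r, r + a ∈ dualCode C → s' (y + r) = -s' y) :
    hadamardConj (diagOp s) * diagOp s' = -(diagOp s' * hadamardConj (diagOp s)) := by
  ext x y
  rw [Matrix.neg_apply, mul_diagOp_apply, diagOp_mul_apply]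
  by_cases hxy : x + y + a ∈ dualCode C
  · have hflip := hs' y (x + y) hxy
    rw [add_left_comm, ZModModule.add_self, add_zero] at hflip
    rw [hflip]
    push_cast
    ring
  · obtain ⟨w, hwC, hw⟩ : ∃ w ∈ C, (x + y + a) ⬝ᵥ w ≠ 0 := by
      by_contra! h
      exact hxy h
    simp [hadamardConj_diagOp_apply_eq_zero (fun z => hs z w hwC) hw]

lemma two_mul_sum_sub_one_le_sum_mul {κ : Type*} [Fintype κ] {p s : κ → ℝ}
    (hp : ∀ x, 0 ≤ p x) (hp1 : ∑ x, p x = 1) (hs : ∀ x, -1 ≤ s x) {K : Finset κ}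
    (hK : ∀ x ∈ K, s x = 1) : 2 * ∑ x ∈ K, p x - 1 ≤ ∑ x, p x * s x := by
  have hle : 2 * ∑ x ∈ K, p x ≤ ∑ x, p x * (s x + 1) := by
    calc 2 * ∑ x ∈ K, p x = ∑ x ∈ K, p x * (s x + 1) := by
          rw [Finset.mul_sum]
          exact Finset.sum_congr rfl fun x hx => by rw [hK x hx]; ring
      _ ≤ ∑ x, p x * (s x + 1) :=
          Finset.sum_le_sum_of_subset_of_nonneg (Finset.subset_univ _) fun x _ _ =>
            mul_nonneg (hp x) (by linarith [hs x])
  simp only [mul_add, mul_one, Finset.sum_add_distrib, hp1] at hle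
  linarith

end Uncertainty

/-! ### Codes and coset weights -/

section Codes

variable {n mX mZ : ℕ}

lemma hammingDist_eq_hammingNorm_add {m : ℕ} (x y : Fin m → ZMod 2) :
    hammingDist x y = hammingNorm (x + y) := by
  rw [hammingDist_eq_hammingNorm, neg_add_eq_sub, ZModModule.sub_eq_add, add_comm]

lemma hammingNorm_add_le {m : ℕ} (x y : Fin m → ZMod 2) :
    hammingNorm (x + y) ≤ hammingNorm x + hammingNorm y := by
  rw [← hammingDist_eq_hammingNorm_add, ← hammingDist_zero_right x, ← hammingDist_zero_left]
  exact hammingDist_triangle x 0 y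

section CosetWeight

variable {N : Submodule (ZMod 2) (Fin n → ZMod 2)}

lemma cosetWeight_le (y : Fin n → ZMod 2) {r : Fin n → ZMod 2} (hr : r ∈ N) :
    cosetWeight N y ≤ hammingNorm (y + r) :=
  ciInf_le (OrderBot.bddBelow _) (⟨r, hr⟩ : N)

variable (N)

lemma cosetWeight_le_hammingNorm (y : Fin n → ZMod 2) : cosetWeight N y ≤ hammingNorm y := by
  simpa using cosetWeight_le y N.zero_mem

lemma exists_hammingNorm_eq_cosetWeight (y : Fin n → ZMod 2) :
    ∃ r ∈ N, hammingNorm (y + r) = cosetWeight N y := by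
  obtain ⟨r, hr⟩ := ciInf_mem fun r : N => hammingNorm (y + (r : Fin n → ZMod 2))
  exact ⟨r, r.2, hr⟩

lemma cosetWeight_add_le (x y : Fin n → ZMod 2) :
    cosetWeight N (x + y) ≤ cosetWeight N x + cosetWeight N y := by
  obtain ⟨r, hr, hxr⟩ := exists_hammingNorm_eq_cosetWeight N x
  obtain ⟨s, hs, hys⟩ := exists_hammingNorm_eq_cosetWeight N y
  refine (cosetWeight_le (x + y) (N.add_mem hr hs)).trans ?_
  rw [← hxr, ← hys, add_add_add_comm]
  exact hammingNorm_add_le _ _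

variable {N}

lemma cosetWeight_eq_zero_iff {y : Fin n → ZMod 2} : cosetWeight N y = 0 ↔ y ∈ N := by
  refine ⟨fun h => ?_, fun hy => ?_⟩
  · obtain ⟨r, hr, hyr⟩ := exists_hammingNorm_eq_cosetWeight N y
    rw [h, hammingNorm_eq_zero, ← ZModModule.sub_eq_add, sub_eq_zero] at hyr
    exact hyr ▸ hr
  · simpa [ZModModule.add_self] using cosetWeight_le y hy

end CosetWeight

namespace CSSCode

variable (Q : CSSCode n mX mZ)

lemma mem_CX_iff {y : Fin n → ZMod 2} : y ∈ Q.CX ↔ Q.HX *ᵥ y = 0 := by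
  rw [CX, LinearMap.mem_ker, Matrix.mulVecLin_apply]

lemma mem_CZ_iff {y : Fin n → ZMod 2} : y ∈ Q.CZ ↔ Q.HZ *ᵥ y = 0 := by
  rw [CZ, LinearMap.mem_ker, Matrix.mulVecLin_apply]

lemma dualCode_CX_le_CZ : dualCode Q.CX ≤ Q.CZ := Q.dual_le

lemma dualCode_CZ_le_CX : dualCode Q.CZ ≤ Q.CX := by
  intro x hx
  rw [mem_CX_iff]
  funext i
  have hrow : Q.HX i ∈ dualCode Q.CX := fun y hy => congrFun (Q.mem_CX_iff.1 hy) i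
  exact (dotProduct_comm _ _).trans (hx _ (Q.dualCode_CX_le_CZ hrow))

lemma exists_logical_pair (h : 0 < Q.dim) : ∃ a ∈ Q.CZ, ∃ b ∈ Q.CX, a ⬝ᵥ b = 1 := by
  have hnot : ¬ Q.CZ ≤ dualCode Q.CX := fun hle =>
    h.ne' (Nat.sub_eq_zero_of_le (Submodule.finrank_mono hle))
  obtain ⟨a, ha, ha'⟩ := SetLike.not_le_iff_exists.1 hnot
  obtain ⟨b, hb, hab⟩ : ∃ b ∈ Q.CX, a ⬝ᵥ b ≠ 0 := by
    by_contra! h'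
    exact ha' h'
  exact ⟨a, ha, b, hb, bit_eq_one_of_ne_zero hab⟩

lemma pos_of_dim_pos (h : 0 < Q.dim) : 0 < n := by
  obtain ⟨a, -, b, -, hab⟩ := Q.exists_logical_pair h
  rcases Nat.eq_zero_or_pos n with rfl | hn
  · simp at hab
  · exact hn

lemma dist_le_cosetWeight_dualCode_CX {y : Fin n → ZMod 2} (hy : y ∈ Q.CZ)
    (hy' : y ∉ dualCode Q.CX) : Q.dist ≤ cosetWeight (dualCode Q.CX) y := by
  obtain ⟨r, hr, hyr⟩ := exists_hammingNorm_eq_cosetWeight (dualCode Q.CX) y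
  exact Nat.sInf_le ⟨y + r, Or.inl ⟨Q.CZ.add_mem hy (Q.dualCode_CX_le_CZ hr), fun h' =>
    hy' (((dualCode Q.CX).add_mem_iff_left hr).1 h')⟩, hyr⟩

lemma dist_le_cosetWeight_dualCode_CZ {y : Fin n → ZMod 2} (hy : y ∈ Q.CX)
    (hy' : y ∉ dualCode Q.CZ) : Q.dist ≤ cosetWeight (dualCode Q.CZ) y := by
  obtain ⟨r, hr, hyr⟩ := exists_hammingNorm_eq_cosetWeight (dualCode Q.CZ) y
  exact Nat.sInf_le ⟨y + r, Or.inr ⟨Q.CX.add_mem hy (Q.dualCode_CZ_le_CX hr), fun h' =>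
    hy' (((dualCode Q.CZ).add_mem_iff_left hr).1 h')⟩, hyr⟩

lemma exists_logical_hammingNorm_eq_dist (h : 0 < Q.dim) :
    ∃ y, ((y ∈ Q.CZ ∧ y ∉ dualCode Q.CX) ∨ (y ∈ Q.CX ∧ y ∉ dualCode Q.CZ)) ∧
      hammingNorm y = Q.dist := by
  obtain ⟨a, ha, b, hb, hab⟩ := Q.exists_logical_pair h
  have ha' : a ∉ dualCode Q.CX := fun ha' => zero_ne_one ((ha' b hb).symm.trans hab)
  exact Nat.sInf_mem (s := {w | ∃ y, ((y ∈ Q.CZ ∧ y ∉ dualCode Q.CX) ∨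
    (y ∈ Q.CX ∧ y ∉ dualCode Q.CZ)) ∧ hammingNorm y = w}) ⟨_, a, Or.inl ⟨ha, ha'⟩, rfl⟩

end CSSCode

end Codes

/-! ### Clusters -/

section Clusters

section Classes

variable {κ : Type*} {p : κ → ℝ} {α μ : ℝ}

lemma exists_subset_le_sum_le_sum_sdiff [DecidableEq κ] {B : Finset κ} (hα : 0 ≤ α) (hμ : 0 < μ)
    (hp : ∀ b ∈ B, p b < α) (hB : α + 2 * μ ≤ ∑ b ∈ B, p b) :
    ∃ S ⊆ B, μ ≤ ∑ b ∈ S, p b ∧ μ ≤ ∑ b ∈ B \ S, p b := by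
  obtain ⟨S, ⟨hSB, hS⟩, hmin⟩ := exists_minimal_of_wellFoundedLT
    (fun S : Finset κ => S ⊆ B ∧ μ ≤ ∑ b ∈ S, p b) ⟨B, subset_rfl, by linarith⟩
  refine ⟨S, hSB, hS, ?_⟩
  obtain ⟨b, hb⟩ : S.Nonempty := Finset.nonempty_of_sum_ne_zero (hμ.trans_le hS).ne'
  have hrest : ∑ x ∈ S.erase b, p x < μ := by
    by_contra! hle
    have hsub := hmin ⟨(S.erase_subset b).trans hSB, hle⟩ (S.erase_subset b)
    exact S.notMem_erase b (hsub hb)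
  have hsum := Finset.add_sum_erase S p hb
  have hcompl := Finset.sum_sdiff (f := p) hSB
  linarith [hp b (hSB hb)]

lemma exists_heavy_class_or_separated {G : Finset κ} {near : κ → κ → Prop} [DecidableRel near]
    (hrefl : ∀ x ∈ G, near x x) (hsymm : ∀ x ∈ G, ∀ y ∈ G, near x y → near y x)
    (htrans : ∀ x ∈ G, ∀ y ∈ G, ∀ z ∈ G, near x y → near y z → near x z)
    (hα : 0 ≤ α) (hμ : 0 < μ) (hG : α + 2 * μ ≤ ∑ x ∈ G, p x) :
    (∃ x ∈ G, α ≤ ∑ y ∈ G with near x y, p y) ∨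
      ∃ S ⊆ G, ∃ T ⊆ G, (∀ x ∈ S, ∀ y ∈ T, ¬ near x y) ∧
        μ ≤ ∑ x ∈ S, p x ∧ μ ≤ ∑ x ∈ T, p x := by
  classical
  rw [or_iff_not_imp_left]
  push Not
  intro hlight
  let cls (x : κ) : Finset κ := {y ∈ G | near x y}
  have hcls {x y : κ} (hx : x ∈ G) (hy : y ∈ G) : cls y = cls x ↔ near x y := by
    refine ⟨fun h => ?_, fun h => Finset.filter_congr fun z hz =>
      ⟨htrans x hx y hy z hz h, htrans y hy x hx z hz (hsymm x hx y hy h)⟩⟩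
    have hmem : y ∈ cls x := h ▸ Finset.mem_filter.2 ⟨hy, hrefl y hy⟩
    exact (Finset.mem_filter.1 hmem).2
  obtain ⟨𝒮, -, hS, hT⟩ := exists_subset_le_sum_le_sum_sdiff
    (p := fun b => ∑ y ∈ G with cls y = b, p y) (B := G.image cls) hα hμ
    (fun b hb => by
      obtain ⟨x, hx, rfl⟩ := Finset.mem_image.1 hb
      rw [Finset.filter_congr fun y hy => hcls hx hy]
      exact hlight x hx)
    (by rwa [Finset.sum_fiberwise_of_maps_to fun x hx => Finset.mem_image_of_mem cls hx])
  rw [Finset.sum_fiberwise_eq_sum_filter] at hS hT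
  refine ⟨_, Finset.filter_subset _ _, _, Finset.filter_subset _ _, fun x hx y hy hxy => ?_,
    hS, hT⟩
  rw [Finset.mem_filter] at hx hy
  exact (Finset.mem_sdiff.1 hy.2).2 ((hcls hx.1 hy.1).2 hxy ▸ hx.2)

lemma one_sub_le_sum_filter_le [Fintype κ] {f : κ → ℝ} {η ν : ℝ} (hp : ∀ x, 0 ≤ p x)
    (hp1 : ∑ x, p x = 1) (hf : ∀ x, 0 ≤ f x) (hη : 0 < η) (hpf : ∑ x, p x * f x ≤ η * ν) :
    1 - ν ≤ ∑ x with f x ≤ η, p x := by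
  classical
  have hmarkov : η * ∑ x with ¬ f x ≤ η, p x ≤ η * ν := by
    calc η * ∑ x with ¬ f x ≤ η, p x ≤ ∑ x with ¬ f x ≤ η, p x * f x := by
          rw [Finset.mul_sum]
          refine Finset.sum_le_sum fun x hx => ?_
          rw [mul_comm]
          exact mul_le_mul_of_nonneg_left (not_le.1 (Finset.mem_filter.1 hx).2).le (hp x)
      _ ≤ ∑ x, p x * f x :=
          Finset.sum_le_sum_of_subset_of_nonneg (Finset.filter_subset _ _) fun x _ _ =>
            mul_nonneg (hp x) (hf x)
      _ ≤ η * ν := hpf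
  have hsplit := Finset.sum_filter_add_sum_filter_not Finset.univ (fun x => f x ≤ η) p
  linarith [le_of_mul_le_mul_left hmarkov hη]

end Classes

variable {n m : ℕ} {H : Matrix (Fin m) (Fin n) (ZMod 2)}
  {N : Submodule (ZMod 2) (Fin n → ZMod 2)} {p : (Fin n → ZMod 2) → ℝ}

lemma violation_le_iff {ε : ℝ} (hε : 0 ≤ ε) {y : Fin n → ZMod 2} :
    violation H y ≤ ε ↔ (hammingNorm (H *ᵥ y) : ℝ) ≤ ε * m := by
  rcases Nat.eq_zero_or_pos m with rfl | hm
  · simp [violation, hε, Subsingleton.elim (H *ᵥ y) 0]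
  · rw [violation, div_le_iff₀ (Nat.cast_pos.2 hm)]

lemma violation_add_le (x y : Fin n → ZMod 2) :
    violation H (x + y) ≤ violation H x + violation H y := by
  rw [violation, violation, violation, ← add_div, Matrix.mulVec_add]
  gcongr
  exact_mod_cast hammingNorm_add_le _ _

/-- The syndrome `H y` of an error `y ∈ K` determines `y` up to stabilizers, the elements
of `N`. -/
def IsDecodable (H : Matrix (Fin m) (Fin n) (ZMod 2)) (N : Submodule (ZMod 2) (Fin n → ZMod 2))
    (K : Finset (Fin n → ZMod 2)) : Prop :=
  ∀ y ∈ K, ∀ y' ∈ K, H *ᵥ y = H *ᵥ y' → y + y' ∈ N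

lemma isSpread_or_exists_isDecodable {η R D α μ : ℝ} (hR : 0 ≤ R) (hRD : 2 * R < D)
    (hcl : ∀ y, violation H y ≤ 2 * η → (cosetWeight N y : ℝ) ≤ R ∨ D ≤ cosetWeight N y)
    (hd : ∀ y, H *ᵥ y = 0 → y ∉ N → R < cosetWeight N y) (hα : 0 ≤ α) (hμ : 0 < μ)
    (hG : α + 2 * μ ≤ ∑ y with violation H y ≤ η, p y) :
    IsSpread p μ D ∨ ∃ K, IsDecodable H N K ∧ α ≤ ∑ y ∈ K, p y := by
  classical
  set G : Finset (Fin n → ZMod 2) := {y | violation H y ≤ η}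
  have hdich : ∀ x ∈ G, ∀ y ∈ G, (cosetWeight N (x + y) : ℝ) ≤ R ∨ D ≤ cosetWeight N (x + y) := by
    intro x hx y hy
    refine hcl _ ((violation_add_le x y).trans ?_)
    linarith [(Finset.mem_filter.1 hx).2, (Finset.mem_filter.1 hy).2]
  have hsymm : ∀ x ∈ G, ∀ y ∈ G, (cosetWeight N (x + y) : ℝ) ≤ R →
      (cosetWeight N (y + x) : ℝ) ≤ R := fun x _ y _ h => by rwa [add_comm]
  have htrans : ∀ x ∈ G, ∀ y ∈ G, ∀ z ∈ G, (cosetWeight N (x + y) : ℝ) ≤ R →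
      (cosetWeight N (y + z) : ℝ) ≤ R → (cosetWeight N (x + z) : ℝ) ≤ R := by
    intro x hx y _ z hz hxy hyz
    have htri : (cosetWeight N (x + z) : ℝ) ≤ cosetWeight N (x + y) + cosetWeight N (y + z) := by
      have h := cosetWeight_add_le N (x + y) (y + z)
      rw [add_assoc, ← add_assoc y, ZModModule.add_self, zero_add] at h
      exact_mod_cast h
    exact (hdich x hx z hz).resolve_right (by linarith)
  have hrefl : ∀ x ∈ G, (cosetWeight N (x + x) : ℝ) ≤ R := fun x _ => by
    rwa [ZModModule.add_self, cosetWeight_eq_zero_iff.2 N.zero_mem, Nat.cast_zero]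
  rcases exists_heavy_class_or_separated hrefl hsymm htrans hα hμ hG with
    ⟨x, hx, hheavy⟩ | ⟨S, hSG, T, hTG, hfar, hS, hT⟩
  · refine Or.inr ⟨_, fun y hy y' hy' hyy' => ?_, hheavy⟩
    rw [Finset.mem_filter] at hy hy'
    by_contra hN
    have hker : H *ᵥ (y + y') = 0 := by rw [Matrix.mulVec_add, hyy', ZModModule.add_self]
    exact (hd _ hker hN).not_ge
      (htrans y hy.1 x hx y' hy'.1 (hsymm x hx y hy.1 hy.2) hy'.2)
  · refine Or.inl ⟨S, T, fun x hx y hy => ?_, hS, hT⟩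
    refine ((hdich x (hSG hx) y (hTG hy)).resolve_left (hfar x hx y hy)).trans ?_
    rw [hammingDist_eq_hammingNorm_add]
    exact_mod_cast cosetWeight_le_hammingNorm N (x + y)

lemma IsDecodable.exists_sign {K : Finset (Fin n → ZMod 2)} (hK : IsDecodable H N K)
    {b : Fin n → ZMod 2} (hb : ∀ r ∈ N, b ⬝ᵥ r = 0) :
    ∃ s : (Fin n → ZMod 2) → ℝ, (∀ y, s y * s y = 1) ∧ (∀ y ∈ K, s y = 1) ∧
      ∀ y w, H *ᵥ w = 0 → s (y + w) = sgn (b ⬝ᵥ w) * s y := by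
  have hdecode (σ : Fin m → ZMod 2) : ∃ g, ∀ y ∈ K, H *ᵥ y = σ → y + g ∈ N := by
    by_cases h : ∃ g ∈ K, H *ᵥ g = σ
    · obtain ⟨g, hgK, hgσ⟩ := h
      exact ⟨g, fun y hy hyσ => hK y hy g hgK (hyσ.trans hgσ.symm)⟩
    · exact ⟨0, fun y hy hyσ => absurd ⟨y, hy, hyσ⟩ h⟩
  choose g hg using hdecode
  refine ⟨fun y => sgn (b ⬝ᵥ (y + g (H *ᵥ y))), fun y => sgn_mul_self _, fun y hy => ?_,
    fun y w hw => ?_⟩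
  · dsimp only
    rw [hb _ (hg _ y hy rfl), AddChar.map_zero_eq_one]
  · dsimp only
    rw [Matrix.mulVec_add, hw, add_zero, ← AddChar.map_add_eq_mul, ← dotProduct_add,
      add_left_comm, add_assoc]

end Clusters

/-! ### The depth lower bound -/

section DepthBound

variable {n mX mZ : ℕ}

namespace CSSCode

lemma anticommute_of_logical_pair (Q : CSSCode n mX mZ) {a b : Fin n → ZMod 2} (ha : a ∈ Q.CZ)
    (hb : b ∈ Q.CX) (hab : a ⬝ᵥ b = 1) {s s' : (Fin n → ZMod 2) → ℝ}
    (hs : ∀ y w, Q.HX *ᵥ w = 0 → s (y + w) = sgn (a ⬝ᵥ w) * s y)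
    (hs' : ∀ y w, Q.HZ *ᵥ w = 0 → s' (y + w) = sgn (b ⬝ᵥ w) * s' y) :
    hadamardConj (diagOp s) * diagOp s' = -(diagOp s' * hadamardConj (diagOp s)) := by
  refine hadamardConj_diagOp_anticommute (C := Q.CX) (a := a)
    (fun z w hw => hs z w (Q.mem_CX_iff.1 hw)) fun y r hr => ?_
  have hrCZ : r ∈ Q.CZ := (Q.CZ.add_mem_iff_left ha).1 (Q.dualCode_CX_le_CZ hr)
  have hbr : b ⬝ᵥ r = 1 := by
    have hsum := hr b hb
    rw [add_dotProduct, hab, ← ZModModule.sub_eq_add, sub_eq_zero] at hsum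
    rw [dotProduct_comm, hsum]
  rw [hs' y r (Q.mem_CZ_iff.1 hrCZ), hbr, sgn_one, neg_one_mul]

lemma sq_add_sq_le_one_of_isDecodable (Q : CSSCode n mX mZ) (hdim : 0 < Q.dim) {ρ : Op (Fin n)}
    (hρ : IsState ρ) {KX KZ : Finset (Fin n → ZMod 2)}
    (hKX : IsDecodable Q.HX (dualCode Q.CZ) KX) (hKZ : IsDecodable Q.HZ (dualCode Q.CX) KZ)
    {α β : ℝ} (hα : 1 / 2 ≤ α) (hβ : 1 / 2 ≤ β) (hX : α ≤ ∑ y ∈ KX, prob (hadamardConj ρ) y)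
    (hZ : β ≤ ∑ y ∈ KZ, prob ρ y) : (2 * α - 1) ^ 2 + (2 * β - 1) ^ 2 ≤ 1 := by
  obtain ⟨a, ha, b, hb, hab⟩ := Q.exists_logical_pair hdim
  obtain ⟨s, hs2, hsK, hs⟩ := hKX.exists_sign (b := a) fun r hr =>
    (dotProduct_comm _ _).trans (hr a ha)
  obtain ⟨s', hs2', hsK', hs'⟩ := hKZ.exists_sign (b := b) fun r hr =>
    (dotProduct_comm _ _).trans (hr b hb)
  have huncertainty := sq_expectation_add_sq_le_one hρ
    ((show IsSelfAdjoint (diagOp s) from isHermitian_diagOp s).map hadamardConj)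
    (isHermitian_diagOp s') (by rw [← map_mul, ← map_mul, show s * s = 1 from funext hs2, map_one,
      map_one]) (by rw [← map_mul, show s' * s' = 1 from funext hs2', map_one])
    (Q.anticommute_of_logical_pair ha hb hab hs hs')
  rw [trace_mul_hadamardConj, trace_mul_diagOp_re, trace_mul_diagOp_re] at huncertainty
  have hsX : 2 * α - 1 ≤ ∑ x, prob (hadamardConj ρ) x * s x :=
    le_trans (by linarith) (two_mul_sum_sub_one_le_sum_mul (prob_nonneg hρ.hadamardConj.1)
      hρ.hadamardConj.sum_prob (fun x => by nlinarith [hs2 x]) hsK)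
  have hsZ : 2 * β - 1 ≤ ∑ x, prob ρ x * s' x :=
    le_trans (by linarith) (two_mul_sum_sub_one_le_sum_mul (prob_nonneg hρ.1)
      hρ.sum_prob (fun x => by nlinarith [hs2' x]) hsK')
  refine le_trans ?_ huncertainty
  gcongr <;> linarith

lemma sum_prob_mul_violation_le (Q : CSSCode n mX mZ) {ε : ℝ} {ρ : Op (Fin n)}
    (hρ : IsApproxGroundState Q.hamiltonian ε ρ) :
    ∑ y, prob (hadamardConj ρ) y * violation Q.HX y ≤ 2 * ε ∧
      ∑ y, prob ρ y * violation Q.HZ y ≤ 2 * ε := by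
  have hX : 0 ≤ ∑ y, prob (hadamardConj ρ) y * violation Q.HX y := Finset.sum_nonneg fun y _ =>
    mul_nonneg (prob_nonneg hρ.1.hadamardConj.1 y) (violation_nonneg _ y)
  have hZ : 0 ≤ ∑ y, prob ρ y * violation Q.HZ y := Finset.sum_nonneg fun y _ =>
    mul_nonneg (prob_nonneg hρ.1.1 y) (violation_nonneg _ y)
  have hE := hρ.2
  rw [Q.trace_mul_hamiltonian_re] at hE
  constructor <;> linarith

lemma nonneg_of_isApproxGroundState (Q : CSSCode n mX mZ) {ε : ℝ} {ρ : Op (Fin n)}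
    (hρ : IsApproxGroundState Q.hamiltonian ε ρ) : 0 ≤ ε := by
  have hZ : 0 ≤ ∑ y, prob ρ y * violation Q.HZ y := Finset.sum_nonneg fun y _ =>
    mul_nonneg (prob_nonneg hρ.1.1 y) (violation_nonneg _ y)
  linarith [(Q.sum_prob_mul_violation_le hρ).2]

lemma isSpread_or_isSpread_of_clustering (Q : CSSCode n mX mZ) {c₁ c₂ ε₀ η : ℝ} (hc₁ : 0 ≤ c₁)
    (hdim : 0 < Q.dim) (hcl : Q.Clustering c₁ c₂ ε₀) (hη : 0 < η) (hηε₀ : 2 * η < ε₀)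
    (hηc : 4 * c₁ * η < c₂) (hηd : 2 * c₁ * η * n < Q.dist) {ρ : Op (Fin n)}
    (hρ : IsApproxGroundState Q.hamiltonian (η / 1000) ρ) :
    IsSpread (prob (hadamardConj ρ)) (1 / 50) (c₂ * n) ∨ IsSpread (prob ρ) (1 / 50) (c₂ * n) := by
  have hn : (0 : ℝ) < n := Nat.cast_pos.2 (Q.pos_of_dim_pos hdim)
  obtain ⟨hclX, hclZ⟩ := hcl (2 * η) (by positivity) hηε₀
  have hRD : 2 * (c₁ * (2 * η) * n) < c₂ * n := by nlinarith
  have hRd : c₁ * (2 * η) * n < Q.dist := by linarith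
  obtain ⟨hEX, hEZ⟩ := Q.sum_prob_mul_violation_le hρ
  have hGX := one_sub_le_sum_filter_le (prob_nonneg hρ.1.hadamardConj.1) hρ.1.hadamardConj.sum_prob
    (violation_nonneg Q.HX) (ν := 1 / 500) hη (by linarith)
  have hGZ := one_sub_le_sum_filter_le (prob_nonneg hρ.1.1) hρ.1.sum_prob
    (violation_nonneg Q.HZ) (ν := 1 / 500) hη (by linarith)
  rcases isSpread_or_exists_isDecodable (p := prob (hadamardConj ρ)) (α := 9 / 10) (μ := 1 / 50)
    (by positivity) hRD
    (fun y hy => hclX y ((violation_le_iff (by positivity)).1 hy))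
    (fun y hy hy' => hRd.trans_le (Nat.cast_le.2
      (Q.dist_le_cosetWeight_dualCode_CZ (Q.mem_CX_iff.2 hy) hy')))
    (by norm_num) (by norm_num) (by linarith) with hX | ⟨KX, hKX, hX⟩
  · exact Or.inl hX
  rcases isSpread_or_exists_isDecodable (p := prob ρ) (α := 9 / 10) (μ := 1 / 50)
    (by positivity) hRD
    (fun y hy => hclZ y ((violation_le_iff (by positivity)).1 hy))
    (fun y hy hy' => hRd.trans_le (Nat.cast_le.2
      (Q.dist_le_cosetWeight_dualCode_CX (Q.mem_CZ_iff.2 hy) hy')))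
    (by norm_num) (by norm_num) (by linarith) with hZ | ⟨KZ, hKZ, hZ⟩
  · exact Or.inr hZ
  · have huncertainty := Q.sq_add_sq_le_one_of_isDecodable hdim hρ.1 hKX hKZ (by norm_num)
      (by norm_num) hX hZ
    norm_num at huncertainty

lemma sq_mul_le_of_isApproxGroundState (Q : CSSCode n mX mZ) {c₁ c₂ ε₀ ε : ℝ}
    (hc₁ : 0 < c₁) (hc₂ : 0 < c₂) (hdim : 0 < Q.dim) (hcl : Q.Clustering c₁ c₂ ε₀)
    (hε : ε < 1 / 1000 * min (ε₀ / 2) (min (c₂ / (4 * c₁)) ((Q.dist : ℝ) / (2 * c₁ * n))))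
    {a : ℕ} (C : Circuit (Fin n ⊕ Fin a))
    (hC : IsApproxGroundState Q.hamiltonian ε C.outputState) :
    c₂ ^ 2 * n ≤ 100 * 4 ^ C.depth := by
  have hn : (0 : ℝ) < n := Nat.cast_pos.2 (Q.pos_of_dim_pos hdim)
  obtain ⟨η, hεη, hη⟩ : ∃ η, 1000 * ε < η ∧
      η < min (ε₀ / 2) (min (c₂ / (4 * c₁)) ((Q.dist : ℝ) / (2 * c₁ * n))) :=
    exists_between (by linarith)
  rw [lt_min_iff, lt_min_iff, lt_div_iff₀ (by positivity), lt_div_iff₀ (by positivity),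
    lt_div_iff₀ (by positivity)] at hη
  obtain ⟨hηε₀, hηc, hηd⟩ := hη
  have hη : 0 < η := by linarith [Q.nonneg_of_isApproxGroundState hC]
  have hspread : 1 / 50 / 2 * (c₂ * n) ^ 2 ≤ n * 4 ^ C.depth := by
    rcases Q.isSpread_or_isSpread_of_clustering hc₁.le hdim hcl hη (by linarith) (by linarith)
      (by linarith) ⟨hC.1, hC.2.trans (by linarith)⟩ with h | h
    · exact C.sq_mul_le_of_isSpread_prob_hadamardConj (by norm_num) (by positivity) h
    · exact C.sq_mul_le_of_isSpread_prob (by norm_num) (by positivity) h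
  refine le_of_mul_le_mul_right ?_ hn
  linarith

end CSSCode

lemma le_depth_of_sq_mul_le {c : ℝ} {N t : ℕ} (hc : 0 < c) (hN : 0 < N)
    (h : c ^ 2 * N ≤ 100 * 4 ^ t) :
    1 / 3 * Real.logb 2 (c ^ 2 * N / (400 * Real.logb 2 (1 / 0.02))) + 1 ≤ t := by
  have hlog : (5 : ℝ) ≤ Real.logb 2 (1 / 0.02) := by
    rw [Real.le_logb_iff_rpow_le (by norm_num) (by norm_num)]
    norm_num
  have : (0 : ℝ) < N := Nat.cast_pos.2 hN
  have hpow : (2 : ℝ) ^ (3 * ((t : ℝ) - 1)) = 8 ^ t / 8 := by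
    rw [mul_sub, mul_one, Real.rpow_sub (by norm_num), Real.rpow_mul (by norm_num),
      Real.rpow_natCast]
    norm_num
  have hle : c ^ 2 * N / (400 * Real.logb 2 (1 / 0.02)) ≤ 8 ^ t / 8 := by
    have h48 : (4 : ℝ) ^ t ≤ 8 ^ t := pow_le_pow_left₀ (by norm_num) (by norm_num) t
    have h8 : (0 : ℝ) < 8 ^ t := by positivity
    rw [div_le_iff₀ (by linarith)]
    nlinarith
  have hlogb := (Real.logb_le_iff_le_rpow one_lt_two (div_pos (by positivity) (by linarith))).2
    (hle.trans_eq hpow.symm)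
  linarith

end DepthBound

/-! ### Small-set expansion -/

section SmallSetExpansion

variable {n mX mZ m : ℕ}

/-- `(c₁, c₂)`-small-set expansion of the parity checks `H` modulo `N`, the common form of boundary
expansion (`H = H_Z`, `N = C_X^⊥`) and coboundary expansion (`H = H_X`, `N = C_Z^⊥`). -/
def IsSmallSetExpander (H : Matrix (Fin m) (Fin n) (ZMod 2))
    (N : Submodule (ZMod 2) (Fin n → ZMod 2)) (c₁ c₂ : ℝ) : Prop :=
  ∀ y : Fin n → ZMod 2, (hammingNorm y : ℝ) ≤ c₁ * n →
    c₂ * ((cosetWeight N y : ℝ) / n) ≤ violation H y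

namespace IsSmallSetExpander

variable {H : Matrix (Fin m) (Fin n) (ZMod 2)} {N : Submodule (ZMod 2) (Fin n → ZMod 2)}
  {c₁ c₂ : ℝ}

lemma cosetWeight_le_or_lt (h : IsSmallSetExpander H N c₁ c₂) (hN : ∀ r ∈ N, H *ᵥ r = 0)
    (hn : 0 < n) (hc₂ : 0 < c₂) {ε : ℝ} {y : Fin n → ZMod 2} (hy : violation H y ≤ ε) :
    (cosetWeight N y : ℝ) ≤ 1 / c₂ * ε * n ∨ c₁ * n < cosetWeight N y := by
  rw [or_iff_not_imp_right, not_lt]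
  intro hsmall
  obtain ⟨r, hr, hyr⟩ := exists_hammingNorm_eq_cosetWeight N y
  have hexp := h (y + r) (by rwa [hyr])
  have hviol : violation H (y + r) = violation H y := by
    rw [violation, violation, Matrix.mulVec_add, hN r hr, add_zero]
  have hcoset : cosetWeight N y ≤ cosetWeight N (y + r) := by
    have hle := cosetWeight_add_le N (y + r) r
    rwa [add_assoc, ZModModule.add_self, add_zero, cosetWeight_eq_zero_iff.2 hr, add_zero] at hle
  have : (0 : ℝ) < n := Nat.cast_pos.2 hn
  calc (cosetWeight N y : ℝ) ≤ cosetWeight N (y + r) := by exact_mod_cast hcoset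
    _ = 1 / c₂ * (c₂ * ((cosetWeight N (y + r) : ℝ) / n)) * n := by field_simp
    _ ≤ 1 / c₂ * ε * n := by gcongr; exact (hexp.trans_eq hviol).trans hy

lemma lt_hammingNorm (h : IsSmallSetExpander H N c₁ c₂) (hN : ∀ r ∈ N, H *ᵥ r = 0)
    (hn : 0 < n) (hc₂ : 0 < c₂) {y : Fin n → ZMod 2} (hy : H *ᵥ y = 0) (hyN : y ∉ N) :
    c₁ * n < hammingNorm y := by
  have hviol : violation H y ≤ 0 := by simp [violation, hy]
  rcases h.cosetWeight_le_or_lt hN hn hc₂ hviol with hle | hlt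
  · rw [mul_zero, zero_mul, Nat.cast_nonpos, cosetWeight_eq_zero_iff] at hle
    exact absurd hle hyN
  · exact hlt.trans_le (Nat.cast_le.2 (cosetWeight_le_hammingNorm N y))

end IsSmallSetExpander

namespace CSSCode

variable (Q : CSSCode n mX mZ) {c₁ c₂ : ℝ}

lemma clustering_of_smallSetExpansion (hc₂ : 0 < c₂) (hdim : 0 < Q.dim)
    (hB : Q.SmallSetBoundaryExpansion c₁ c₂) (hC : Q.SmallSetCoboundaryExpansion c₁ c₂) (ε₀ : ℝ) :
    Q.Clustering (1 / c₂) c₁ ε₀ := by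
  intro ε hε _
  have hn := Q.pos_of_dim_pos hdim
  refine ⟨fun y hy => ?_, fun y hy => ?_⟩
  · exact (IsSmallSetExpander.cosetWeight_le_or_lt hC
      (fun r hr => Q.mem_CX_iff.1 (Q.dualCode_CZ_le_CX hr)) hn hc₂
      ((violation_le_iff hε.le).2 hy)).imp_right le_of_lt
  · exact (IsSmallSetExpander.cosetWeight_le_or_lt hB
      (fun r hr => Q.mem_CZ_iff.1 (Q.dualCode_CX_le_CZ hr)) hn hc₂
      ((violation_le_iff hε.le).2 hy)).imp_right le_of_lt

lemma lt_dist_of_smallSetExpansion (hc₂ : 0 < c₂) (hdim : 0 < Q.dim)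
    (hB : Q.SmallSetBoundaryExpansion c₁ c₂) (hC : Q.SmallSetCoboundaryExpansion c₁ c₂) :
    c₁ * n < Q.dist := by
  have hn := Q.pos_of_dim_pos hdim
  obtain ⟨y, ⟨hy, hy'⟩ | ⟨hy, hy'⟩, hyd⟩ := Q.exists_logical_hammingNorm_eq_dist hdim
  · rw [← hyd]
    exact IsSmallSetExpander.lt_hammingNorm hB
      (fun r hr => Q.mem_CZ_iff.1 (Q.dualCode_CX_le_CZ hr)) hn hc₂ (Q.mem_CZ_iff.1 hy) hy'
  · rw [← hyd]
    exact IsSmallSetExpander.lt_hammingNorm hC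
      (fun r hr => Q.mem_CX_iff.1 (Q.dualCode_CZ_le_CX hr)) hn hc₂ (Q.mem_CX_iff.1 hy) hy'

lemma sq_mul_le_of_smallSetExpansion (hc₁ : 0 < c₁) (hc₂ : 0 < c₂) (hdim : 0 < Q.dim)
    (hB : Q.SmallSetBoundaryExpansion c₁ c₂) (hC : Q.SmallSetCoboundaryExpansion c₁ c₂) {ε : ℝ}
    (hε : ε < 1 / 1000 * min (1 / 2) (c₁ * c₂ / 4)) {a : ℕ} (C : Circuit (Fin n ⊕ Fin a))
    (hρ : IsApproxGroundState Q.hamiltonian ε C.outputState) :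
    c₁ ^ 2 * n ≤ 100 * 4 ^ C.depth := by
  have hn : (0 : ℝ) < n := Nat.cast_pos.2 (Q.pos_of_dim_pos hdim)
  refine Q.sq_mul_le_of_isApproxGroundState (one_div_pos.2 hc₂) hc₁ hdim
    (Q.clustering_of_smallSetExpansion hc₂ hdim hB hC 1) (hε.trans_le ?_) C hρ
  have hdist : c₁ * c₂ / 4 ≤ (Q.dist : ℝ) / (2 * (1 / c₂) * n) := by
    rw [le_div_iff₀ (by positivity)]
    calc c₁ * c₂ / 4 * (2 * (1 / c₂) * n) = c₁ * n / 2 := by field_simp; ring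
      _ ≤ c₁ * n := half_le_self (by positivity)
      _ ≤ Q.dist := (Q.lt_dist_of_smallSetExpansion hc₂ hdim hB hC).le
  have hratio : c₁ / (4 * (1 / c₂)) = c₁ * c₂ / 4 := by field_simp
  rw [hratio, min_eq_left hdist]

end CSSCode

end SmallSetExpansion

lemma natCast_le_minDepth_iff {n : ℕ} {H : Op (Fin n)} {ε : ℝ} {K : ℕ} :
    (K : ℕ∞) ≤ minDepth H ε ↔ ∀ (a : ℕ) (C : Circuit (Fin n ⊕ Fin a)),
      IsApproxGroundState H ε C.outputState → K ≤ C.depth := by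
  rw [minDepth, le_sInf_iff]
  refine ⟨fun h a C hC => Nat.cast_le.1 (h _ ⟨a, C, hC, rfl⟩), ?_⟩
  rintro h _ ⟨a, C, hC, rfl⟩
  exact Nat.cast_le.2 (h a C hC)

theorem isNLTS_of_smallSetExpansion {n mX mZ : ℕ → ℕ} (Q : (j : ℕ) → CSSCode (n j) (mX j) (mZ j))
    {ℓ : ℕ} {c₁ c₂ : ℝ} (hc₁ : 0 < c₁) (hc₂ : 0 < c₂) (hn : Tendsto n atTop atTop)
    (hX : ∀ j i, hammingNorm ((Q j).HX i) ≤ ℓ) (hZ : ∀ j i, hammingNorm ((Q j).HZ i) ≤ ℓ)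
    (hdim : ∀ j, 0 < (Q j).dim)
    (hB : ∀ j, (Q j).SmallSetBoundaryExpansion c₁ c₂)
    (hC : ∀ j, (Q j).SmallSetCoboundaryExpansion c₁ c₂) :
    IsNLTS n fun j => (Q j).hamiltonian := by
  obtain ⟨ε, hε, hε'⟩ : ∃ ε, 0 < ε ∧ ε < 1 / 1000 * min (1 / 2) (c₁ * c₂ / 4) :=
    exists_between (by positivity)
  refine ⟨⟨ℓ, fun j => (Q j).isLocalHamiltonian_hamiltonian (hX j) (hZ j)⟩,
    fun j => ⟨(Q j).posSemidef_hamiltonian, (Q j).posSemidef_one_sub_hamiltonian⟩, ε, hε, ?_⟩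
  rw [ENat.tendsto_nhds_top_iff_natCast_lt]
  intro K
  have hlarge : Tendsto (fun j => c₁ ^ 2 * (n j : ℝ)) atTop atTop :=
    (tendsto_natCast_atTop_atTop.comp hn).const_mul_atTop (by positivity)
  filter_upwards [hlarge.eventually_gt_atTop (100 * 4 ^ K)] with j hj
  refine (Nat.cast_lt.2 K.lt_succ_self).trans_le (natCast_le_minDepth_iff.2 fun a C hρ => ?_)
  have hdepth := (Q j).sq_mul_le_of_smallSetExpansion hc₁ hc₂ (hdim j) (hB j) (hC j) hε' C hρ
  exact (pow_lt_pow_iff_right₀ (by norm_num : (1 : ℝ) < 4)).1 (by linarith)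

end NLTS

end

theorem mainTheorem2_general :
    (∀ (n mX mZ : ℕ) (Q : NLTS.CSSCode n mX mZ) (c₁ c₂ ε₀ ε : ℝ),
      0 < c₁ → 0 < c₂ →
      0 < Q.dim →
      Q.Clustering c₁ c₂ ε₀ →
      ε < 1 / 1000 * min (ε₀ / 2) (min (c₂ / (4 * c₁)) ((Q.dist : ℝ) / (2 * c₁ * n))) →
      ∀ (a : ℕ) (C : NLTS.Circuit (Fin n ⊕ Fin a)),
        NLTS.IsApproxGroundState Q.hamiltonian ε C.outputState →
          1 / 3 * Real.logb 2 (c₂ ^ 2 * n / (400 * Real.logb 2 (1 / 0.02))) + 1 ≤ C.depth) ∧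
    (∀ (n mX mZ : ℕ → ℕ) (Q : (j : ℕ) → NLTS.CSSCode (n j) (mX j) (mZ j))
      (ℓ : ℕ) (c₁ c₂ : ℝ),
      0 < c₁ → 0 < c₂ →
      Tendsto n atTop atTop →
      (∀ j i, hammingNorm ((Q j).HX i) ≤ ℓ) →
      (∀ j i, hammingNorm ((Q j).HZ i) ≤ ℓ) →
      (∀ j, 0 < (Q j).dim) →
      (∀ j, (Q j).SmallSetBoundaryExpansion c₁ c₂) →
      (∀ j, (Q j).SmallSetCoboundaryExpansion c₁ c₂) →
      NLTS.IsNLTS n fun j => (Q j).hamiltonian) := by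
  refine ⟨fun n mX mZ Q c₁ c₂ ε₀ ε hc₁ hc₂ hdim hcl hε a C hC => ?_,
    fun n mX mZ Q ℓ c₁ c₂ hc₁ hc₂ hn hX hZ hdim hB hC => ?_⟩
  · exact NLTS.le_depth_of_sq_mul_le hc₂ (Q.pos_of_dim_pos hdim)
      (Q.sq_mul_le_of_isApproxGroundState hc₁ hc₂ hdim hcl hε C hC)
  · exact NLTS.isNLTS_of_smallSetExpansion Q hc₁ hc₂ hn hX hZ hdim hB hC

theorem mainTheorem2 :
    -- the depth lower bound
    (∀ (n mX mZ : ℕ) (Q : NLTS.CSSCode n mX mZ) (c₁ c₂ ε₀ ε : ℝ),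
      0 < c₁ → 0 < c₂ → 0 < ε₀ →
      0 < Q.dim →
      Q.Clustering c₁ c₂ ε₀ →
      ε < 1 / 1000 * min (ε₀ / 2) (min (c₂ / (4 * c₁)) ((Q.dist : ℝ) / (2 * c₁ * n))) →
      ∀ ρ : NLTS.Op (Fin n), NLTS.IsApproxGroundState Q.hamiltonian ε ρ →
        ¬ ∃ (a : ℕ) (C : NLTS.Circuit (Fin n ⊕ Fin a)),
          NLTS.Circuit.outputState C = ρ ∧
          (NLTS.Circuit.depth C : ℝ) <
            1 / 3 * Real.logb 2 (c₂ ^ 2 * n / (400 * Real.logb 2 (1 / 0.02))) + 1) ∧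
    -- low-rate codes with small-set expansion give NLTS Hamiltonians
    (∀ (n mX mZ : ℕ → ℕ) (Q : (j : ℕ) → NLTS.CSSCode (n j) (mX j) (mZ j))
      (ℓ : ℕ) (c₁ c₂ : ℝ),
      0 < c₁ → 0 < c₂ →
      Filter.Tendsto n Filter.atTop Filter.atTop →
      (∀ j, (Q j).HasLocality ℓ) →
      (∀ j, 0 < (Q j).dim) →
      (∀ j, (Q j).SmallSetBoundaryExpansion c₁ c₂) →
      (∀ j, (Q j).SmallSetCoboundaryExpansion c₁ c₂) →
      NLTS.IsNLTS n (fun j => (Q j).hamiltonian)) := by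
  refine ⟨?_, ?_⟩
  · rintro n mX mZ Q c₁ c₂ ε₀ ε hc₁ hc₂ - hdim hcl hε _ hρ ⟨a, C, rfl, hdepth⟩
    exact hdepth.not_ge (mainTheorem2_general.1 n mX mZ Q c₁ c₂ ε₀ ε hc₁ hc₂ hdim hcl hε a C hρ)
  · intro n mX mZ Q ℓ c₁ c₂ hc₁ hc₂ hn hℓ
    exact mainTheorem2_general.2 n mX mZ Q ℓ c₁ c₂ hc₁ hc₂ hn (fun j => (hℓ j).1)
      fun j => (hℓ j).2.2.1
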